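/- \textbf{Theorem (Contraction analysis of time-varying primal-dual dynamics).} Let $1\le k<n$, let $A\in\mathbb{R}^{k\times n}$ have full row rank, let $b:\mathbb{R}_{\ge 0}\to\mathbb{R}^k$ and $f:\mathbb{R}^n\times\mathbb{R}_{\ge 0}\to\mathbb{R}$, and let $\ell_{\inf},\ell_{\sup}>0$. Write $\nabla f$ and $\nabla^2 f$ for the gradient and Hessian in $x$. Assume that, for all $(x,t)\in\mathbb{R}^n\times\mathbb{R}_{\ge 0}$, the map $x\mapsto f(x,t)$ is twice continuously differentiable with $\ell_{\inf}I_n\preceq\nabla^2f(x,t)\preceq\ell_{\sup}I_n$, and that $t\mapsto\nabla f(x,t)$ and $t\mapsto b(t)$ are continuously differentiable. Consider the problem $\min_{x}f(x,t)$ subject to $Ax=b(t)$, and its primal-dual dynamics $$\dot x=-\nabla f(x,t)-A^\top\nu,\qquad \dot\nu=Ax-b(t).$$ Let $\sigma_{\max}(A),\sigma_{\min}(A)$ be the largest and smallest of the $k$ singular values of $A$. For $0<\epsilon<1$ put $$\alpha_\epsilon=\frac{\epsilon\,\ell_{\inf}}{\sigma_{\max}^2(A)+\frac34\sigma_{\max}(A)\sigma_{\min}^2(A)+\ell_{\sup}^2},\quad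 P=\begin{bmatrix}I_n&\alpha_\epsilon A^\top\\ \alpha_\epsilon A&I_k\end{bmatrix},\quad c=\alpha_\epsilon\,\frac34\,\frac{\sigma_{\max}(A)\sigma_{\min}^2(A)}{\sigma_{\max}(A)+1},$$ and $\|z\|_{2,P^{1/2}}=\|P^{1/2}z\|_2$. Then: (1) $P$ is positive definite, and the primal-dual dynamics are contractive with respect to $\|\cdot\|_{2,P^{1/2}}$ with contraction rate $c$. That is, $c>0$; trajectories exist on $[t_0,\infty)$ from every initial time $t_0\ge 0$ and state; any two trajectories satisfy $\|z(t)-w(t)\|_{2,P^{1/2}}\le\|z(t_0)-w(t_0)\|_{2,P^{1/2}}\,e^{-c(t-t_0)}$ for $t\ge t_0\ge 0$; and the Jacobian in $(x,\nu)$ of the right-hand side has, at every state and every time $t\ge 0$, matrix measure at most $-c$, where the matrix measure is $\mu(M)=\lim_{h\to0^+}(\|I+hM\|-1)/h$ with the operator norm induced by $\|\cdot\|_{2,P^{1/2}}$. (2) For every $t\ge 0$ there is a unique pair $z^*(t)=(x^*(t),\nu^*(t))$ consisting of a minimizer $x^*(t)$ of $f(\cdot,t)$ subject to $Ax=b(t)$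 and an associated Lagrange multiplier $\nu^*(t)$, i.e. $\nabla f(x^*(t),t)+A^\top\nu^*(t)=0$. If $\beta_1,\beta_2>0$ are such that $\|\dot b(t)\|_2\le\beta_1$ and $\|\frac{\partial}{\partial t}\nabla f(x,t)\|_2\le\beta_2$ for all $x\in\mathbb{R}^n$, $t\ge 0$, then every trajectory $z(t)=(x(t),\nu(t))$ on $[0,\infty)$ satisfies, for all $t\ge 0$, $$\|z(t)-z^*(t)\|_{2,P^{1/2}}\le\Big(\|z(0)-z^*(0)\|_{2,P^{1/2}}-\frac{\rho}{c}\Big)e^{-ct}+\frac{\rho}{c},$$ where, with $\lambda_{\max}(P)$ the largest eigenvalue of $P$, $$\rho=\lambda_{\max}(P)\left(\frac{\beta_2}{\ell_{\inf}}+\Big(\frac{\sigma_{\max}(A)}{\ell_{\inf}}+1\Big)\frac{\ell_{\sup}}{\sigma_{\min}^2(A)}\Big(\beta_1+\frac{\sigma_{\max}(A)}{\ell_{\inf}}\beta_2\Big)\right).$$ In particular, the tracking error is uniformly ultimately bounded by $\rho/c$: for all $\delta,R>0$ there is $T\ge 0$ such that, for every $t_0\ge0$ and every trajectory on $[t_0,\infty)$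 with $\|z(t_0)-z^*(t_0)\|_{2,P^{1/2}}\le R$, one has $\|z(t)-z^*(t)\|_{2,P^{1/2}}\le\rho/c+\delta$ for all $t\ge t_0+T$. -/

import Mathlib

open scoped MatrixOrder Matrix

noncomputable section

namespace PrimalDual

/-- The matrix `M` acting on Euclidean vectors. -/
def mulE {m n : ℕ} (M : Matrix (Fin m) (Fin n) ℝ) (x : EuclideanSpace ℝ (Fin n)) :
    EuclideanSpace ℝ (Fin m) :=
  WithLp.toLp 2 (M *ᵥ x.ofLp)

/-- The largest singular value. -/
def sigmaMax {m n : ℕ} (M : Matrix (Fin m) (Fin n) ℝ) : ℝ :=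
  (Matrix.toEuclideanLin M).singularValues 0

/-- The smallest of the `min m n` singular values of an `m × n` matrix. Mathlib lists the
singular values in nonincreasing order, starting with index `0`. -/
def sigmaMin {m n : ℕ} (M : Matrix (Fin m) (Fin n) ℝ) : ℝ :=
  (Matrix.toEuclideanLin M).singularValues (min m n - 1)

/-- The largest eigenvalue of a matrix whose eigenvalues are all real. -/
def lambdaMax {ι : Type*} [Fintype ι] [DecidableEq ι] (M : Matrix ι ι ℝ) : ℝ :=
  sSup (spectrum ℝ M)

/-- The weighted norm `‖x‖_{2,Q} = ‖Q x‖₂`. -/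
def weightedNorm {ι : Type*} [Fintype ι] (Q : Matrix ι ι ℝ) (x : EuclideanSpace ℝ ι) : ℝ :=
  ‖(WithLp.toLp 2 (Q *ᵥ x.ofLp) : EuclideanSpace ℝ ι)‖

/-! ### Contraction of time-varying systems `ż = F(z, t)`, `t ≥ 0` -/

section Contraction

variable {E : Type*} [NormedAddCommGroup E] [NormedSpace ℝ E]

/-- `z` solves `ż = F(z, t)` on `[t₀, ∞)`, with the one-sided derivative at `t₀`. -/
def IsTrajectory (F : E → ℝ → E) (t₀ : ℝ) (z : ℝ → E) : Prop :=
  ∀ t ∈ Set.Ici t₀, HasDerivWithinAt z (F (z t) t) (Set.Ici t₀) t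

/-- Contractivity with exponent `c` with respect to the norm `N`: every initial value problem
has a trajectory for all future times, and any two trajectories approach each other at
rate `c`. -/
structure IsContractive (N : E → ℝ) (F : E → ℝ → E) (c : ℝ) : Prop where
  pos : 0 < c
  exists_trajectory : ∀ t₀ : ℝ, 0 ≤ t₀ → ∀ z₀ : E, ∃ z : ℝ → E, IsTrajectory F t₀ z ∧ z t₀ = z₀
  dist_le : ∀ t₀ : ℝ, 0 ≤ t₀ → ∀ z w : ℝ → E, IsTrajectory F t₀ z → IsTrajectory F t₀ w →
    ∀ t : ℝ, t₀ ≤ t → N (z t - w t) ≤ N (z t₀ - w t₀) * Real.exp (-c * (t - t₀))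

/-- The operator norm induced by the vector norm `N`. -/
def inducedNorm (N : E → ℝ) (T : E →L[ℝ] E) : ℝ :=
  sInf {C : ℝ | 0 ≤ C ∧ ∀ v : E, N (T v) ≤ C * N v}

/-- `m = lim_{h → 0⁺} (‖I + h T‖ - 1) / h` is the matrix measure of `T` associated to `N`. -/
def IsMatrixMeasure (N : E → ℝ) (T : E →L[ℝ] E) (m : ℝ) : Prop :=
  Filter.Tendsto (fun h : ℝ => (inducedNorm N (ContinuousLinearMap.id ℝ E + h • T) - 1) / h)
    (nhdsWithin 0 (Set.Ioi 0)) (nhds m)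

/-- The matrix measure of the Jacobian is at most `-c` at all states and all times `t ≥ 0`. -/
def HasContractionRate (N : E → ℝ) (F : E → ℝ → E) (c : ℝ) : Prop :=
  ∀ t : ℝ, 0 ≤ t → ∀ z : E, DifferentiableAt ℝ (fun y => F y t) z ∧
    ∃ m : ℝ, IsMatrixMeasure N (fderiv ℝ (fun y => F y t) z) m ∧ m ≤ -c

end Contraction

/-! ### The time-varying problem `min f(x, t)` subject to `A x = b(t)` -/

section Problem

variable {n k : ℕ}

/-- The space of pairs `z = (x, ν)`, with the Euclidean norm. -/
abbrev State (n k : ℕ) : Type := EuclideanSpace ℝ (Fin n ⊕ Fin k)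

/-- The component `x` of `z = (x, ν)`. -/
def primal (z : State n k) : EuclideanSpace ℝ (Fin n) :=
  WithLp.toLp 2 (fun i => z (Sum.inl i))

/-- The component `ν` of `z = (x, ν)`. -/
def dual (z : State n k) : EuclideanSpace ℝ (Fin k) :=
  WithLp.toLp 2 (fun j => z (Sum.inr j))

/-- The pair `(x, ν)`. -/
def stack (x : EuclideanSpace ℝ (Fin n)) (ν : EuclideanSpace ℝ (Fin k)) : State n k :=
  WithLp.toLp 2 (Sum.elim x.ofLp ν.ofLp)

/-- The gradient in `x` of `f(x, t)`. -/
def grad (f : EuclideanSpace ℝ (Fin n) → ℝ → ℝ) (x : EuclideanSpace ℝ (Fin n)) (t : ℝ) :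
    EuclideanSpace ℝ (Fin n) :=
  gradient (fun y => f y t) x

/-- The Hessian in `x` of `f(x, t)`, as the derivative of the gradient. -/
def hess (f : EuclideanSpace ℝ (Fin n) → ℝ → ℝ) (x : EuclideanSpace ℝ (Fin n)) (t : ℝ) :
    EuclideanSpace ℝ (Fin n) →L[ℝ] EuclideanSpace ℝ (Fin n) :=
  fderiv ℝ (fun y => grad f y t) x

/-- The primal-dual vector field `(x, ν), t ↦ (-∇f(x, t) - Aᵀ ν, A x - b(t))`. -/
def field (A : Matrix (Fin k) (Fin n) ℝ) (b : ℝ → EuclideanSpace ℝ (Fin k))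
    (f : EuclideanSpace ℝ (Fin n) → ℝ → ℝ) (z : State n k) (t : ℝ) : State n k :=
  stack (-grad f (primal z) t - mulE Aᵀ (dual z)) (mulE A (primal z) - b t)

/-- `z = (x, ν)`, where `x` minimizes `f(·, t)` subject to `A x = b(t)` and `ν` is an associated
Lagrange multiplier. -/
structure IsOptimizer (A : Matrix (Fin k) (Fin n) ℝ) (b : ℝ → EuclideanSpace ℝ (Fin k))
    (f : EuclideanSpace ℝ (Fin n) → ℝ → ℝ) (t : ℝ) (z : State n k) : Prop where
  feasible : mulE A (primal z) = b t
  minimal : ∀ y : EuclideanSpace ℝ (Fin n), mulE A y = b t → f (primal z) t ≤ f y t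
  multiplier : grad f (primal z) t + mulE Aᵀ (dual z) = 0

/-- The parameter `α_ε`. -/
def alpha (A : Matrix (Fin k) (Fin n) ℝ) (linf lsup ε : ℝ) : ℝ :=
  ε * linf / (sigmaMax A ^ 2 + 3 / 4 * sigmaMax A * sigmaMin A ^ 2 + lsup ^ 2)

/-- The weight matrix `P = [I, α_ε Aᵀ; α_ε A, I]`. -/
def weightP (A : Matrix (Fin k) (Fin n) ℝ) (linf lsup ε : ℝ) :
    Matrix (Fin n ⊕ Fin k) (Fin n ⊕ Fin k) ℝ :=
  Matrix.fromBlocks 1 (alpha A linf lsup ε • Aᵀ) (alpha A linf lsup ε • A) 1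

/-- The norm `‖·‖_{2,P^{1/2}}`, with the positive semidefinite square root of `P`. -/
def normP (A : Matrix (Fin k) (Fin n) ℝ) (linf lsup ε : ℝ) (z : State n k) : ℝ :=
  weightedNorm (CFC.sqrt (weightP A linf lsup ε)) z

/-- The contraction rate `c`. -/
def rate (A : Matrix (Fin k) (Fin n) ℝ) (linf lsup ε : ℝ) : ℝ :=
  alpha A linf lsup ε * (3 / 4) * (sigmaMax A * sigmaMin A ^ 2 / (sigmaMax A + 1))

/-- The constant `ρ` of the tracking bound. -/
def rho (A : Matrix (Fin k) (Fin n) ℝ) (linf lsup ε β₁ β₂ : ℝ) : ℝ :=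
  lambdaMax (weightP A linf lsup ε) *
    (β₂ / linf + (sigmaMax A / linf + 1) *
      (lsup / sigmaMin A ^ 2 * (β₁ + sigmaMax A / linf * β₂)))

end Problem

end PrimalDual

end

/-! Put `S = P^{1/2}` and let `F` be the primal-dual field. Everything rests on one inequality: `⟪S
(z - w), S (F z t - F w t)⟫ ≤ -c ‖S (z - w)‖²`, that is, `F` is dissipative in the inner product of
`P`.

To get it, average the Hessian along the segment between the two primal components
(`exists_symmetric_map_sub_eq`). The average `H` is symmetric with the same bounds, and the
increment of `F` is the saddle matrix `J = [-H, -Aᵀ; A, 0]` applied to `z - w`. What remains is the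
quadratic form inequality `P J + Jᵀ P ≤ -2 c P` (`saddle_form_le`). The off-diagonal blocks of `P`
create the term `-α ‖Aᵀ ν‖²`, which supplies the damping in `ν` that `J` alone lacks. A quarter of
it pays for the cross terms, and the remaining `3/4` gives the rate. The size of `α` ensures that
the strong convexity of `f` covers all terms in `x`.

For a Lipschitz dissipative field, an Euler step of length `h` contracts by `1 - c h + O(h²)`
(`norm_map_add_smul_le`). This single estimate yields the decay between trajectories through
Grönwall's inequality, the bound on the matrix measure, and a zero of `F(·, t)` as the limit of
Euler iterates. By convexity that zero is exactly the optimizer with its multiplier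
(`isOptimizer_iff`).

For tracking, `z*` is never differentiated. Subtracting the optimality systems at two times shows
that `t ↦ S z*(t)` is `ρ`-Lipschitz (`saddle_sensitivity`, `norm_optimizer_sub_le`). As `F` vanishes
along `z*`, this curve solves the equation up to a defect `ρ`, and the Grönwall comparison
`norm_map_sub_le_of_defect` gives the stated bound. -/

noncomputable section

namespace PrimalDual

open Filter Set Topology
open scoped NNReal

/-! ### Dissipative fields: Euler steps, comparison of curves, zeros -/

section Weighted

variable {E : Type*} [NormedAddCommGroup E] [InnerProductSpace ℝ E]

/-- A short Euler step along a direction that is dissipative in the norm `‖S ·‖` contracts. -/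
theorem norm_map_add_smul_le (S : E →L[ℝ] E) {c C h : ℝ} (hh : 0 ≤ h) {d u : E}
    (hmono : inner ℝ (S d) (S u) ≤ -c * ‖S d‖ ^ 2) (hlip : ‖S u‖ ≤ C * ‖S d‖) :
    ‖S (d + h • u)‖ ≤ (1 - c * h + C ^ 2 * h ^ 2 / 2) * ‖S d‖ := by
  have hsq : ‖S (d + h • u)‖ ^ 2 =
      ‖S d‖ ^ 2 + 2 * h * inner ℝ (S d) (S u) + h ^ 2 * ‖S u‖ ^ 2 := by
    rw [map_add, map_smul, norm_add_sq_real, inner_smul_right, norm_smul, mul_pow,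
      Real.norm_eq_abs, sq_abs]
    ring
  have hu2 : ‖S u‖ ^ 2 ≤ C ^ 2 * ‖S d‖ ^ 2 := by
    rw [← mul_pow]
    exact pow_le_pow_left₀ (norm_nonneg _) hlip 2
  have hle : ‖S (d + h • u)‖ ^ 2 ≤ (1 - 2 * (c * h) + C ^ 2 * h ^ 2) * ‖S d‖ ^ 2 := by
    rw [hsq]
    have h1 := mul_le_mul_of_nonneg_left hmono (by positivity : 0 ≤ 2 * h)
    have h2 := mul_le_mul_of_nonneg_left hu2 (sq_nonneg h)
    linarith
  -- If `S d = 0` the coefficient may be negative, but both sides vanish. Otherwise `hle` bounds a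
  -- square, which forces its coefficient to be nonnegative, and `1 + 2 w ≤ (1 + w)²` removes the
  -- root.
  rcases (norm_nonneg (S d)).eq_or_lt with h0 | h0
  · rw [← h0] at hle ⊢
    have : ‖S (d + h • u)‖ ^ 2 ≤ 0 := by simpa using hle
    simpa using this
  · have hpos : 0 ≤ 1 - 2 * (c * h) + C ^ 2 * h ^ 2 := by
      by_contra hneg
      have : (1 - 2 * (c * h) + C ^ 2 * h ^ 2) * ‖S d‖ ^ 2 < 0 :=
        mul_neg_of_neg_of_pos (not_le.mp hneg) (by positivity)
      linarith [sq_nonneg ‖S (d + h • u)‖]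
    have hX : 0 ≤ 1 - c * h + C ^ 2 * h ^ 2 / 2 := by linarith
    refine le_of_sq_le_sq ?_ (by positivity)
    refine hle.trans ?_
    rw [mul_pow]
    refine mul_le_mul_of_nonneg_right ?_ (sq_nonneg _)
    nlinarith [sq_nonneg (-(c * h) + C ^ 2 * h ^ 2 / 2)]

/-- `F(·, t)` is, for all `t ≥ 0`, globally Lipschitz and strongly dissipative for the inner
product `⟪S ·, S ·⟫`, and it is continuous in time. -/
structure IsDissipative (S : E →L[ℝ] E) (F : E → ℝ → E) (c K m : ℝ) : Prop where
  rate_pos : 0 < c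
  lip_nonneg : 0 ≤ K
  lower_pos : 0 < m
  lower : ∀ v, m * ‖v‖ ≤ ‖S v‖
  lipschitz : ∀ t, 0 ≤ t → ∀ z w, ‖F z t - F w t‖ ≤ K * ‖z - w‖
  mono : ∀ t, 0 ≤ t → ∀ z w,
    inner ℝ (S (z - w)) (S (F z t - F w t)) ≤ -c * ‖S (z - w)‖ ^ 2
  continuousOn : ∀ z, ContinuousOn (F z) (Ici 0)

namespace IsDissipative

variable {S : E →L[ℝ] E} {F : E → ℝ → E} {c K m : ℝ}

theorem norm_map_sub_le (hF : IsDissipative S F c K m) {t : ℝ} (ht : 0 ≤ t) (z w : E) :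
    ‖S (F z t - F w t)‖ ≤ ‖S‖ * K / m * ‖S (z - w)‖ := by
  have hm := hF.lower_pos
  calc ‖S (F z t - F w t)‖ ≤ ‖S‖ * ‖F z t - F w t‖ := S.le_opNorm _
    _ ≤ ‖S‖ * (K * ‖z - w‖) := by gcongr; exact hF.lipschitz t ht z w
    _ = ‖S‖ * K / m * (m * ‖z - w‖) := by field_simp
    _ ≤ _ := by
        have := hF.lip_nonneg
        gcongr
        exact hF.lower _

theorem euler_step_le (hF : IsDissipative S F c K m) {t h : ℝ} (ht : 0 ≤ t) (hh : 0 ≤ h)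
    (z w : E) :
    ‖S (z - w + h • (F z t - F w t))‖ ≤
      (1 - c * h + (‖S‖ * K / m) ^ 2 * h ^ 2 / 2) * ‖S (z - w)‖ :=
  norm_map_add_smul_le S hh (hF.mono t ht z w) (hF.norm_map_sub_le ht z w)

/-- Comparison of a trajectory with a curve that solves the equation up to a defect `ρ`. -/
theorem norm_map_sub_le_of_defect (hF : IsDissipative S F c K m) {t₀ ρ : ℝ} (ht₀ : 0 ≤ t₀)
    {z y : ℝ → E} (hz : IsTrajectory F t₀ z) (hyc : ContinuousOn y (Ici t₀))
    (hy : ∀ t, t₀ ≤ t → ∀ η, 0 < η → ∀ᶠ s in 𝓝[>] t,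
      ‖S (y s - y t - (s - t) • F (y t) t)‖ ≤ (ρ + η) * (s - t))
    {t : ℝ} (ht : t₀ ≤ t) :
    ‖S (z t - y t)‖ ≤
      (‖S (z t₀ - y t₀)‖ - ρ / c) * Real.exp (-c * (t - t₀)) + ρ / c := by
  have hc := hF.rate_pos
  have hzc : ContinuousOn z (Ici t₀) := fun s hs => (hz s hs).continuousWithinAt
  have hV : ContinuousOn (fun s => ‖S (z s - y s)‖) (Icc t₀ t) :=
    ((S.continuous.comp_continuousOn (hzc.sub hyc)).norm).mono Icc_subset_Ici_self
  -- The version with a lower right Dini derivative is needed because `y` need not be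
  -- differentiable.
  have key := le_gronwallBound_of_liminf_deriv_right_le (f := fun s => ‖S (z s - y s)‖)
    (f' := fun s => -c * ‖S (z s - y s)‖ + ρ) (δ := ‖S (z t₀ - y t₀)‖) (K := -c) (ε := ρ)
    (a := t₀) (b := t) hV ?_ le_rfl (fun s _ => le_rfl) t ⟨ht, le_rfl⟩
  · rw [gronwallBound_of_K_ne_0 (by linarith)] at key
    refine key.trans (le_of_eq ?_)
    field_simp
    ring
  · intro x hx r hr
    have hx0 : 0 ≤ x := ht₀.trans hx.1
    set C := ‖S‖ * K / m
    set V := ‖S (z x - y x)‖ with hVdef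
    -- The slack below `r` is `4 η`. Three errors, each at most `η`, are spent: the linearization of
    -- `z`, the excess defect of `y`, and the quadratic term of the Euler step.
    set η := (r - (-c * V + ρ)) / 4 with hη
    have hηpos : 0 < η := by rw [hη]; linarith
    have hzder : HasDerivWithinAt z (F (z x) x) (Ioi x) x :=
      (hz x hx.1).mono (Ioi_subset_Ici_self.trans (Ici_subset_Ici.2 hx.1))
    have h1 : ∀ᶠ s in 𝓝[>] x, ‖S (z s - z x - (s - x) • F (z x) x)‖ ≤ η * (s - x) := by
      have := (hzder.isLittleO).def (c := η / (‖S‖ + 1)) (by positivity)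
      filter_upwards [this, self_mem_nhdsWithin] with s hs hsx
      have hpos : 0 < s - x := sub_pos.2 hsx
      have hs' : ‖z s - z x - (s - x) • F (z x) x‖ ≤ η / (‖S‖ + 1) * (s - x) := by
        simpa [Real.norm_eq_abs, abs_of_pos hpos] using hs
      calc _ ≤ ‖S‖ * ‖z s - z x - (s - x) • F (z x) x‖ := S.le_opNorm _
        _ ≤ (‖S‖ + 1) * (η / (‖S‖ + 1) * (s - x)) := by gcongr; linarith
        _ = _ := by field_simp
    have h2 := hy x hx.1 η hηpos
    have h3 : ∀ᶠ s in 𝓝[>] x, C ^ 2 * (s - x) / 2 * V < η := by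
      have : ContinuousAt (fun s => C ^ 2 * (s - x) / 2 * V) x := by fun_prop
      refine this.continuousWithinAt.eventually_lt_const ?_
      simpa using hηpos
    refine Eventually.frequently ?_
    filter_upwards [h1, h2, h3, self_mem_nhdsWithin] with s hs1 hs2 hs3 hsx
    have hpos : 0 < s - x := sub_pos.2 hsx
    have h4 := hF.euler_step_le hx0 hpos.le (z x) (y x)
    have h5 : ‖S (z s - y s)‖ ≤
        ‖S (z x - y x + (s - x) • (F (z x) x - F (y x) x))‖ +
          ‖S (z s - z x - (s - x) • F (z x) x)‖ +
          ‖S (y s - y x - (s - x) • F (y x) x)‖ := by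
      have : z s - y s = (z x - y x + (s - x) • (F (z x) x - F (y x) x)) +
          (z s - z x - (s - x) • F (z x) x) - (y s - y x - (s - x) • F (y x) x) := by
        rw [smul_sub]; abel
      rw [this, map_sub, map_add]
      exact (norm_sub_le _ _).trans (add_le_add_left (norm_add_le _ _) _)
    rw [inv_mul_lt_iff₀ hpos]
    have h6 : ‖S (z s - y s)‖ - V ≤
        (-c * V + ρ + 2 * η + C ^ 2 * (s - x) / 2 * V) * (s - x) := by
      nlinarith [h4, h5, hs1, hs2]
    refine h6.trans_lt ?_
    rw [mul_comm]
    refine mul_lt_mul_of_pos_left ?_ hpos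
    rw [hη] at hs3 ⊢
    linarith

/-- A second trajectory is a comparison curve with defect `0`. -/
theorem dist_trajectories_le (hF : IsDissipative S F c K m) {t₀ : ℝ} (ht₀ : 0 ≤ t₀)
    {z w : ℝ → E} (hz : IsTrajectory F t₀ z) (hw : IsTrajectory F t₀ w)
    {t : ℝ} (ht : t₀ ≤ t) :
    ‖S (z t - w t)‖ ≤ ‖S (z t₀ - w t₀)‖ * Real.exp (-c * (t - t₀)) := by
  have := hF.norm_map_sub_le_of_defect (ρ := 0) ht₀ hz
    (fun s hs => (hw s hs).continuousWithinAt) ?_ ht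
  · simpa using this
  · intro x hx η hη
    have hder : HasDerivWithinAt w (F (w x) x) (Ioi x) x :=
      (hw x hx).mono (Ioi_subset_Ici_self.trans (Ici_subset_Ici.2 hx))
    have := (hder.isLittleO).def (c := η / (‖S‖ + 1)) (by positivity)
    filter_upwards [this, self_mem_nhdsWithin] with s hs hsx
    have hpos : 0 < s - x := sub_pos.2 hsx
    have hs' : ‖w s - w x - (s - x) • F (w x) x‖ ≤ η / (‖S‖ + 1) * (s - x) := by
      simpa [Real.norm_eq_abs, abs_of_pos hpos] using hs
    calc _ ≤ ‖S‖ * ‖w s - w x - (s - x) • F (w x) x‖ := S.le_opNorm _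
      _ ≤ (‖S‖ + 1) * (η / (‖S‖ + 1) * (s - x)) := by gcongr; linarith
      _ = _ := by field_simp; ring

/-- A strongly dissipative Lipschitz map has a zero, the limit of Euler steps. -/
theorem exists_zero [CompleteSpace E] (hF : IsDissipative S F c K m) {t : ℝ} (ht : 0 ≤ t) :
    ∃ z, F z t = 0 := by
  have hc := hF.rate_pos
  have hm := hF.lower_pos
  set C := ‖S‖ * K / m with hC
  obtain ⟨h, hh, hq0, hq1⟩ : ∃ h : ℝ, 0 < h ∧ 0 ≤ 1 - c * h + C ^ 2 * h ^ 2 / 2 ∧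
      1 - c * h + C ^ 2 * h ^ 2 / 2 < 1 := by
    -- This step has `c h ≤ 1`, so the factor is nonnegative, and `C² h ≤ c`, so the factor is at
    -- most `1 - c h / 2`.
    refine ⟨c / (C ^ 2 + c ^ 2), by positivity, ?_, ?_⟩
    · have : c * (c / (C ^ 2 + c ^ 2)) ≤ 1 := by
        rw [← mul_div_assoc, div_le_one (by positivity)]
        nlinarith [sq_nonneg C]
      have : 0 ≤ C ^ 2 * (c / (C ^ 2 + c ^ 2)) ^ 2 / 2 := by positivity
      linarith
    · set h := c / (C ^ 2 + c ^ 2) with hh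
      have hpos : 0 < h := by positivity
      have : C ^ 2 * h ≤ c := by
        rw [hh, ← mul_div_assoc, div_le_iff₀ (by positivity)]
        nlinarith [sq_nonneg C, pow_pos hc 3]
      nlinarith [mul_pos hc hpos]
  set q := 1 - c * h + C ^ 2 * h ^ 2 / 2 with hq
  let G : E → E := fun z => z + h • F z t
  have hG : ∀ z w, ‖S (G z - G w)‖ ≤ q * ‖S (z - w)‖ := by
    intro z w
    have : G z - G w = z - w + h • (F z t - F w t) := by
      simp only [G, smul_sub]; abel
    rw [this]
    exact hF.euler_step_le ht hh.le z w
  let x : ℕ → E := fun j => G^[j] 0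
  have hx : ∀ j, x (j + 1) = G (x j) := fun j => Function.iterate_succ_apply' G j 0
  have hstep : ∀ j, ‖S (x (j + 1) - x j)‖ ≤ ‖S (x 1 - x 0)‖ * q ^ j := by
    intro j
    induction j with
    | zero => simp
    | succ j ih =>
      calc ‖S (x (j + 1 + 1) - x (j + 1))‖ ≤ q * ‖S (x (j + 1) - x j)‖ := by
            conv_lhs => rw [hx (j + 1), hx j]
            simpa only [hx j] using hG (G (x j)) (x j)
        _ ≤ q * (‖S (x 1 - x 0)‖ * q ^ j) := by gcongr
        _ = _ := by ring
  -- The iteration contracts in `‖S ·‖` only; the lower bound `m` carries the geometric decay over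
  -- to the norm of `E`.
  have hcauchy : CauchySeq x := by
    refine cauchySeq_of_le_geometric q (‖S (x 1 - x 0)‖ / m) hq1 fun j => ?_
    rw [dist_comm, dist_eq_norm, div_mul_eq_mul_div, le_div_iff₀ hm, mul_comm]
    exact (hF.lower _).trans (hstep j)
  obtain ⟨z, hz⟩ := cauchySeq_tendsto_of_complete hcauchy
  have hFc : Continuous (fun y => F y t) :=
    (LipschitzWith.of_dist_le_mul (K := ⟨K, hF.lip_nonneg⟩) fun a b => by
      rw [dist_eq_norm, dist_eq_norm]
      exact hF.lipschitz t ht a b).continuous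
  have hGc : Continuous G := continuous_id.add (hFc.const_smul h)
  have h1 : Tendsto (fun j => x (j + 1)) atTop (𝓝 (G z)) := by
    simp only [hx]
    exact (hGc.tendsto z).comp hz
  have h2 := tendsto_nhds_unique h1 ((tendsto_add_atTop_iff_nat 1).2 hz)
  refine ⟨z, ?_⟩
  have : h • F z t = 0 := by simpa [G] using h2
  exact (smul_eq_zero.1 this).resolve_left hh.ne'

theorem zero_unique (hF : IsDissipative S F c K m) {t : ℝ} (ht : 0 ≤ t) {z w : E}
    (hz : F z t = 0) (hw : F w t = 0) : z = w := by
  have h1 := hF.mono t ht z w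
  have hc := hF.rate_pos
  have hm := hF.lower_pos
  rw [hz, hw] at h1
  simp only [sub_self, map_zero, inner_zero_right] at h1
  have h2 : ‖S (z - w)‖ = 0 := by
    have : ‖S (z - w)‖ ^ 2 ≤ 0 := by nlinarith
    simpa using this
  have h3 := hF.lower (z - w)
  rw [h2] at h3
  have h4 : ‖z - w‖ ≤ 0 := by
    by_contra hn
    exact absurd h3 (not_le.2 (mul_pos hm (not_le.1 hn)))
  exact sub_eq_zero.1 (norm_le_zero_iff.1 h4)

end IsDissipative

end Weighted

/-! ### Global forward solutions of Lipschitz equations -/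

section GlobalExistence

variable {E : Type*} [NormedAddCommGroup E] [NormedSpace ℝ E]

/-- Two solutions on adjacent intervals that match at the common endpoint can be glued. -/
theorem exists_glue_Icc {F : E → ℝ → E} {a s u : ℝ} (has : a ≤ s) (hsu : s ≤ u) {α β : ℝ → E}
    (hα : ∀ t ∈ Icc a s, HasDerivWithinAt α (F (α t) t) (Icc a s) t)
    (hβ : ∀ t ∈ Icc s u, HasDerivWithinAt β (F (β t) t) (Icc s u) t) (hαβ : α s = β s) :
    ∃ γ : ℝ → E, γ a = α a ∧ ∀ t ∈ Icc a u, HasDerivWithinAt γ (F (γ t) t) (Icc a u) t := by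
  classical
  let γ : ℝ → E := fun t => if t ≤ s then α t else β t
  have hγα : ∀ t, t ≤ s → γ t = α t := fun t ht => if_pos ht
  have hγβ : ∀ t, s ≤ t → γ t = β t := by
    intro t ht
    rcases ht.eq_or_lt with rfl | h
    · rw [hγα _ le_rfl, hαβ]
    · exact if_neg (not_le.2 h)
  have h1 : ∀ t ∈ Icc a s, HasDerivWithinAt γ (F (γ t) t) (Icc a s) t := by
    intro t ht
    rw [hγα t ht.2]
    exact (hα t ht).congr (fun x hx => hγα x hx.2) (hγα t ht.2)
  have h2 : ∀ t ∈ Icc s u, HasDerivWithinAt γ (F (γ t) t) (Icc s u) t := by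
    intro t ht
    rw [hγβ t ht.1]
    exact (hβ t ht).congr (fun x hx => hγβ x hx.1) (hγβ t ht.1)
  refine ⟨γ, hγα a has, fun t ht => ?_⟩
  rcases lt_trichotomy t s with h | h | h
  · refine (h1 t ⟨ht.1, h.le⟩).mono_of_mem_nhdsWithin ?_
    filter_upwards [self_mem_nhdsWithin, mem_nhdsWithin_of_mem_nhds (Iio_mem_nhds h)] with x hx hxs
    exact ⟨hx.1, le_of_lt hxs⟩
  · subst h
    have := (h1 t ⟨ht.1, le_rfl⟩).union (h2 t ⟨le_rfl, ht.2⟩)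
    rwa [Icc_union_Icc_eq_Icc has hsu] at this
  · refine (h2 t ⟨h.le, ht.2⟩).mono_of_mem_nhdsWithin ?_
    filter_upwards [self_mem_nhdsWithin, mem_nhdsWithin_of_mem_nhds (Ioi_mem_nhds h)] with x hx hxs
    exact ⟨le_of_lt hxs, hx.2⟩

variable [CompleteSpace E]

/-- For a globally Lipschitz field the Picard-Lindelöf theorem applies with a uniform time step. -/
theorem exists_solution_Icc_step {F : E → ℝ → E} {K : ℝ} (hK : 0 ≤ K)
    (hlip : ∀ t, 0 ≤ t → ∀ z w, ‖F z t - F w t‖ ≤ K * ‖z - w‖)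
    (hcont : ∀ z, ContinuousOn (F z) (Ici 0)) {s : ℝ} (hs : 0 ≤ s) (z₀ : E) :
    ∃ α : ℝ → E, α s = z₀ ∧ ∀ t ∈ Icc s (s + 1 / (2 * (K + 1))),
      HasDerivWithinAt α (F (α t) t) (Icc s (s + 1 / (2 * (K + 1)))) t := by
  set δ := 1 / (2 * (K + 1)) with hδ
  have hδ0 : 0 < δ := by positivity
  have hsub : Icc s (s + δ) ⊆ Ici 0 := fun t ht => hs.trans ht.1
  obtain ⟨M, hM⟩ := isCompact_Icc.exists_bound_of_continuousOn ((hcont z₀).mono hsub)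
  have hM0 : 0 ≤ M := (norm_nonneg _).trans (hM s ⟨le_rfl, by linarith⟩)
  let K' : ℝ≥0 := ⟨K, hK⟩
  -- The radius scales with the bound `M` at the centre, so the field is at most `M (2 K + 1) / (K +
  -- 1)` on the ball, and the condition "speed times `δ` at most radius" no longer involves `M`.
  -- This makes `δ` uniform.
  let a : ℝ≥0 := ⟨M / (K + 1), by positivity⟩
  let L : ℝ≥0 := ⟨M + K * (M / (K + 1)), by positivity⟩
  have hpl : IsPicardLindelof (fun t z => F z t) (tmin := s) (tmax := s + δ)
      ⟨s, le_rfl, by linarith⟩ z₀ a 0 L K' := by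
    refine ⟨fun t ht => ?_, fun x _ => (hcont x).mono hsub, fun t ht x hx => ?_, ?_⟩
    · refine LipschitzWith.lipschitzOnWith (LipschitzWith.of_dist_le_mul fun x y => ?_)
      rw [dist_eq_norm, dist_eq_norm]
      exact hlip t (hsub ht) x y
    · have h1 : ‖F x t‖ ≤ ‖F z₀ t‖ + ‖F x t - F z₀ t‖ := by
        have := norm_add_le (F z₀ t) (F x t - F z₀ t)
        rwa [add_sub_cancel] at this
      have h2 := hlip t (hsub ht) x z₀
      have h3 : ‖x - z₀‖ ≤ M / (K + 1) := mem_closedBall_iff_norm.1 hx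
      have h4 := mul_le_mul_of_nonneg_left h3 hK
      have h5 := hM t ht
      change ‖F x t‖ ≤ M + K * (M / (K + 1))
      linarith
    · have : max (s + δ - s) (s - s) = δ := by
        rw [sub_self, add_sub_cancel_left]; exact max_eq_left hδ0.le
      simp only [NNReal.coe_zero, sub_zero]
      rw [this]
      change (M + K * (M / (K + 1))) * δ ≤ M / (K + 1)
      rw [hδ]
      field_simp
      nlinarith
  exact hpl.exists_eq_forall_mem_Icc_hasDerivWithinAt₀

/-- A globally Lipschitz field, continuous in time, has global forward trajectories. -/
theorem exists_isTrajectory {F : E → ℝ → E} {K : ℝ} (hK : 0 ≤ K)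
    (hlip : ∀ t, 0 ≤ t → ∀ z w, ‖F z t - F w t‖ ≤ K * ‖z - w‖)
    (hcont : ∀ z, ContinuousOn (F z) (Ici 0)) {t₀ : ℝ} (ht₀ : 0 ≤ t₀) (z₀ : E) :
    ∃ z : ℝ → E, IsTrajectory F t₀ z ∧ z t₀ = z₀ := by
  set δ := 1 / (2 * (K + 1)) with hδ
  have hδ0 : 0 < δ := by positivity
  have hN : ∀ N : ℕ, ∃ α : ℝ → E, α t₀ = z₀ ∧ ∀ t ∈ Icc t₀ (t₀ + N * δ),
      HasDerivWithinAt α (F (α t) t) (Icc t₀ (t₀ + N * δ)) t := by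
    intro N
    induction N with
    | zero =>
      refine ⟨fun _ => z₀, rfl, fun t ht => ?_⟩
      have : Icc t₀ (t₀ + (0 : ℕ) * δ) = {t} := by
        have h := ht
        simp only [Nat.cast_zero, zero_mul, add_zero, Icc_self, mem_singleton_iff] at h ⊢
        rw [h]
      rw [this]
      exact HasFDerivWithinAt.of_subsingleton subsingleton_singleton
    | succ N ih =>
      obtain ⟨α, hα0, hα⟩ := ih
      obtain ⟨β, hβ0, hβ⟩ := exists_solution_Icc_step hK hlip hcont
        (s := t₀ + N * δ) (by positivity) (α (t₀ + N * δ))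
      obtain ⟨γ, hγ0, hγ⟩ := exists_glue_Icc (F := F) (by nlinarith [N.cast_nonneg (α := ℝ)])
        (by linarith) hα hβ hβ0.symm
      have : t₀ + ((N + 1 : ℕ) : ℝ) * δ = t₀ + N * δ + δ := by push_cast; ring
      rw [this]
      exact ⟨γ, hγ0.trans hα0, hγ⟩
  choose α hα0 hα using hN
  have huniq : ∀ N M : ℕ, N ≤ M → EqOn (α N) (α M) (Icc t₀ (t₀ + N * δ)) := by
    intro N M hNM
    have hle : t₀ + N * δ ≤ t₀ + M * δ := by
      have : (N : ℝ) ≤ M := by exact_mod_cast hNM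
      gcongr
    have hsub : Icc t₀ (t₀ + N * δ) ⊆ Icc t₀ (t₀ + M * δ) := Icc_subset_Icc_right hle
    have hright : ∀ {J : ℕ} {t : ℝ}, t ∈ Ico t₀ (t₀ + J * δ) →
        HasDerivWithinAt (α J) (F (α J t) t) (Ici t) t := fun {J t} ht =>
      (hα J t (Ico_subset_Icc_self ht)).mono_of_mem_nhdsWithin
        (mem_of_superset (Icc_mem_nhdsGE ht.2) (Icc_subset_Icc_left ht.1))
    refine ODE_solution_unique_of_mem_Icc_right (v := fun t z => F z t) (s := fun _ => univ)
      (K := ⟨K, hK⟩) (fun t ht => ?_)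
      (fun t ht => (hα N t ht).continuousWithinAt) (fun t ht => hright ht) (fun _ _ => mem_univ _)
      (fun t ht => ((hα M t (hsub ht)).continuousWithinAt).mono hsub)
      (fun t ht => hright (Ico_subset_Ico_right hle ht)) (fun _ _ => mem_univ _)
      ((hα0 N).trans (hα0 M).symm)
    refine LipschitzWith.lipschitzOnWith (LipschitzWith.of_dist_le_mul fun x y => ?_)
    rw [dist_eq_norm, dist_eq_norm]
    exact hlip t (ht₀.trans ht.1) x y
  let idx : ℝ → ℕ := fun t => ⌈(t - t₀) / δ⌉₊
  have hidx : ∀ t, t ≤ t₀ + idx t * δ := by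
    intro t
    have := Nat.le_ceil ((t - t₀) / δ)
    rw [div_le_iff₀ hδ0] at this
    linarith
  let z : ℝ → E := fun t => α (idx t) t
  have hz : ∀ (N : ℕ) (t : ℝ), t ∈ Icc t₀ (t₀ + N * δ) → z t = α N t := by
    intro N t ht
    rcases le_total (idx t) N with h | h
    · exact huniq _ _ h ⟨ht.1, hidx t⟩
    · exact (huniq _ _ h ht).symm
  refine ⟨z, fun t ht => ?_, ?_⟩
  · set N := idx t + 1
    have htN : t < t₀ + N * δ := by
      have := hidx t
      simp only [N, Nat.cast_add, Nat.cast_one]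
      linarith
    have htI : t ∈ Icc t₀ (t₀ + N * δ) := ⟨ht, htN.le⟩
    have h1 : HasDerivWithinAt z (F (z t) t) (Icc t₀ (t₀ + N * δ)) t := by
      rw [hz N t htI]
      exact (hα N t htI).congr (hz N) (hz N t htI)
    refine h1.mono_of_mem_nhdsWithin ?_
    filter_upwards [self_mem_nhdsWithin, mem_nhdsWithin_of_mem_nhds (Iio_mem_nhds htN)] with x hx hx'
    exact ⟨hx, le_of_lt hx'⟩
  · exact hα0 _

end GlobalExistence

/-! ### Existence and bound of the matrix measure -/

section MatrixMeasure

variable {E : Type*} [NormedAddCommGroup E] [InnerProductSpace ℝ E]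

theorem bddBelow_inducedNorm_set (N : E → ℝ) (T : E →L[ℝ] E) :
    BddBelow {C : ℝ | 0 ≤ C ∧ ∀ v : E, N (T v) ≤ C * N v} :=
  ⟨0, fun _ hC => hC.1⟩

theorem inducedNorm_le {N : E → ℝ} {T : E →L[ℝ] E} {C : ℝ} (hC : 0 ≤ C)
    (h : ∀ v, N (T v) ≤ C * N v) : inducedNorm N T ≤ C :=
  csInf_le (bddBelow_inducedNorm_set N T) ⟨hC, h⟩

section

variable {S : E →L[ℝ] E} {m : ℝ}

/-- Guards against the default value of `sInf` on the empty set. -/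
theorem inducedNorm_set_nonempty (hm : 0 < m) (hS : ∀ v, m * ‖v‖ ≤ ‖S v‖) (T : E →L[ℝ] E) :
    {C : ℝ | 0 ≤ C ∧ ∀ v : E, ‖S (T v)‖ ≤ C * ‖S v‖}.Nonempty := by
  refine ⟨‖S‖ * ‖T‖ / m, by positivity, fun v => ?_⟩
  calc ‖S (T v)‖ ≤ ‖S‖ * (‖T‖ * ‖v‖) := (S.le_opNorm _).trans (by gcongr; exact T.le_opNorm v)
    _ = ‖S‖ * ‖T‖ / m * (m * ‖v‖) := by field_simp
    _ ≤ _ := by gcongr; exact hS v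

theorem inducedNorm_nonneg (N : E → ℝ) (T : E →L[ℝ] E) : 0 ≤ inducedNorm N T :=
  Real.sInf_nonneg fun _ hC => hC.1

theorem le_inducedNorm_mul (hm : 0 < m) (hS : ∀ v, m * ‖v‖ ≤ ‖S v‖) (T : E →L[ℝ] E) (v : E) :
    ‖S (T v)‖ ≤ inducedNorm (fun v => ‖S v‖) T * ‖S v‖ := by
  rcases (norm_nonneg (S v)).eq_or_lt with h | h
  · obtain ⟨C, -, hC⟩ := inducedNorm_set_nonempty hm hS T
    have := hC v
    rw [← h] at this ⊢
    simpa using this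
  · rw [← div_le_iff₀ h]
    refine le_csInf (inducedNorm_set_nonempty hm hS T) fun C hC => ?_
    rw [div_le_iff₀ h]
    exact hC.2 v

/-- The triangle inequality at one nonzero vector. It bounds the difference quotient of the matrix
measure below, so that its infimum is a genuine limit. -/
theorem one_le_inducedNorm_id_add [Nontrivial E] (hm : 0 < m) (hS : ∀ v, m * ‖v‖ ≤ ‖S v‖)
    (T : E →L[ℝ] E) {h : ℝ} (hh : 0 ≤ h) :
    1 - h * inducedNorm (fun v => ‖S v‖) T ≤
      inducedNorm (fun v => ‖S v‖) (ContinuousLinearMap.id ℝ E + h • T) := by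
  obtain ⟨v, hv⟩ := exists_ne (0 : E)
  have hSv : 0 < ‖S v‖ := (mul_pos hm (norm_pos_iff.2 hv)).trans_le (hS v)
  have h1 := le_inducedNorm_mul hm hS (ContinuousLinearMap.id ℝ E + h • T) v
  have h2 := le_inducedNorm_mul hm hS T v
  have h3 : ‖S v‖ ≤ ‖S ((ContinuousLinearMap.id ℝ E + h • T) v)‖ + h * ‖S (T v)‖ := by
    have : S v = S ((ContinuousLinearMap.id ℝ E + h • T) v) - h • S (T v) := by simp
    calc ‖S v‖ = ‖S ((ContinuousLinearMap.id ℝ E + h • T) v) - h • S (T v)‖ := by rw [← this]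
      _ ≤ _ := by
        refine (norm_sub_le _ _).trans ?_
        rw [norm_smul, Real.norm_of_nonneg hh]
  have h4 := mul_le_mul_of_nonneg_left h2 hh
  refine le_of_mul_le_mul_right ?_ hSv
  linarith

/-- `h ↦ ‖I + h T‖` is convex with value at most `1` at `h = 0`, so its slopes from `0` increase.
The limit at `0⁺` therefore exists once they are bounded below. -/
theorem inducedNorm_quotient_mono (hm : 0 < m) (hS : ∀ v, m * ‖v‖ ≤ ‖S v‖)
    (T : E →L[ℝ] E) :
    MonotoneOn (fun h : ℝ => (inducedNorm (fun v => ‖S v‖)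
      (ContinuousLinearMap.id ℝ E + h • T) - 1) / h) (Ioi 0) := by
  intro h₁ hh₁ h₂ hh₂ hle
  rw [mem_Ioi] at hh₁ hh₂
  set g : ℝ → ℝ := fun h => inducedNorm (fun v => ‖S v‖) (ContinuousLinearMap.id ℝ E + h • T)
  change (g h₁ - 1) / h₁ ≤ (g h₂ - 1) / h₂
  set l := h₁ / h₂ with hl
  have hl0 : 0 ≤ l := by positivity
  have hl1 : l ≤ 1 := (div_le_one hh₂).2 hle
  -- Convexity in the form `I + h₁ T = (1 - l) I + l (I + h₂ T)`.
  have key : g h₁ ≤ (1 - l) + l * g h₂ := by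
    refine inducedNorm_le ?_ fun v => ?_
    · have := inducedNorm_nonneg (fun v => ‖S v‖) (ContinuousLinearMap.id ℝ E + h₂ • T)
      have := mul_nonneg hl0 this
      simp only [g]
      linarith
    · have hv : S ((ContinuousLinearMap.id ℝ E + h₁ • T) v) =
          (1 - l) • S v + l • S ((ContinuousLinearMap.id ℝ E + h₂ • T) v) := by
        have : l * h₂ = h₁ := by rw [hl]; field_simp
        simp only [add_apply, ContinuousLinearMap.id_apply,
          smul_apply, map_add, map_smul, smul_add, smul_smul, this, sub_smul,
          one_smul]
        abel
      change ‖S _‖ ≤ _ * ‖S v‖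
      rw [hv]
      have := le_inducedNorm_mul hm hS (ContinuousLinearMap.id ℝ E + h₂ • T) v
      have := mul_le_mul_of_nonneg_left this hl0
      refine (norm_add_le _ _).trans ?_
      rw [norm_smul, norm_smul, Real.norm_of_nonneg hl0, Real.norm_of_nonneg (by linarith)]
      simp only [g]
      linarith
  have : g h₁ - 1 ≤ l * (g h₂ - 1) := by linarith
  rw [div_le_div_iff₀ hh₁ hh₂]
  calc (g h₁ - 1) * h₂ ≤ l * (g h₂ - 1) * h₂ := by gcongr
    _ = _ := by rw [hl]; field_simp

/-- The matrix measure exists, and a dissipativity estimate bounds it. -/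
theorem exists_isMatrixMeasure_le [Nontrivial E] (hm : 0 < m) (hS : ∀ v, m * ‖v‖ ≤ ‖S v‖)
    (T : E →L[ℝ] E) {c : ℝ} (hT : ∀ v, inner ℝ (S v) (S (T v)) ≤ -c * ‖S v‖ ^ 2) :
    ∃ μ, IsMatrixMeasure (fun v => ‖S v‖) T μ ∧ μ ≤ -c := by
  set q : ℝ → ℝ := fun h => (inducedNorm (fun v => ‖S v‖)
      (ContinuousLinearMap.id ℝ E + h • T) - 1) / h with hq
  set C := inducedNorm (fun v => ‖S v‖) T
  have hbdd : BddBelow (q '' Ioi 0) := by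
    refine ⟨-C, ?_⟩
    rintro _ ⟨h, hh, rfl⟩
    rw [mem_Ioi] at hh
    have := one_le_inducedNorm_id_add hm hS T hh.le
    simp only [hq]
    rw [le_div_iff₀ hh]
    linarith
  have hlim := (inducedNorm_quotient_mono hm hS T).tendsto_nhdsGT hbdd
  refine ⟨_, hlim, ?_⟩
  have hup : Tendsto (fun h : ℝ => -c + C ^ 2 * h / 2) (𝓝[>] 0) (𝓝 (-c)) := by
    have : ContinuousAt (fun h : ℝ => -c + C ^ 2 * h / 2) 0 := by fun_prop
    simpa using this.tendsto.mono_left nhdsWithin_le_nhds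
  have hsmall : ∀ᶠ h : ℝ in 𝓝[>] 0, c * h < 1 := by
    have : ContinuousAt (fun h : ℝ => c * h) 0 := by fun_prop
    refine this.continuousWithinAt.eventually_lt_const ?_
    simp
  refine le_of_tendsto_of_tendsto hlim hup ?_
  filter_upwards [self_mem_nhdsWithin, hsmall] with h hh hch
  rw [mem_Ioi] at hh
  rw [div_le_iff₀ hh]
  have : inducedNorm (fun v => ‖S v‖) (ContinuousLinearMap.id ℝ E + h • T) ≤
      1 - c * h + C ^ 2 * h ^ 2 / 2 := by
    refine inducedNorm_le ?_ fun v => ?_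
    · have : 0 ≤ C ^ 2 * h ^ 2 / 2 := by positivity
      linarith
    · simpa using norm_map_add_smul_le S hh.le (hT v) (le_inducedNorm_mul hm hS T v)
  nlinarith

end

end MatrixMeasure

namespace IsDissipative

variable {E : Type*} [NormedAddCommGroup E] [InnerProductSpace ℝ E] [CompleteSpace E]
  {S : E →L[ℝ] E} {F : E → ℝ → E} {c K m : ℝ}

theorem isContractive (hF : IsDissipative S F c K m) : IsContractive (fun v => ‖S v‖) F c where
  pos := hF.rate_pos
  exists_trajectory _ ht₀ z₀ :=
    exists_isTrajectory hF.lip_nonneg hF.lipschitz hF.continuousOn ht₀ z₀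
  dist_le _ ht₀ _ _ hz hw _ ht := hF.dist_trajectories_le ht₀ hz hw ht

end IsDissipative

/-! ### Norm bounds from extreme singular values -/

section SingularValues

variable {E F : Type*} [NormedAddCommGroup E] [InnerProductSpace ℝ E] [FiniteDimensional ℝ E]
  [NormedAddCommGroup F] [InnerProductSpace ℝ F] [FiniteDimensional ℝ F]

/-- Expand `⟪x, T* T x⟫` in an orthonormal eigenbasis of `T* T`, whose eigenvalues are the squared
singular values. -/
theorem norm_sq_eq_sum_singularValues (T : E →ₗ[ℝ] F) (x : E) :
    ‖T x‖ ^ 2 = ∑ i : Fin (Module.finrank ℝ E), T.singularValues i ^ 2 *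
      inner ℝ (T.isSymmetric_adjoint_comp_self.eigenvectorBasis rfl i) x ^ 2 := by
  set e := T.isSymmetric_adjoint_comp_self.eigenvectorBasis rfl with he
  have h1 : ‖T x‖ ^ 2 = inner ℝ x ((LinearMap.adjoint T ∘ₗ T) x) := by
    rw [LinearMap.comp_apply, LinearMap.adjoint_inner_right, real_inner_self_eq_norm_sq]
  rw [h1, ← e.sum_inner_mul_inner]
  refine Finset.sum_congr rfl fun i _ => ?_
  have h2 : inner ℝ (e i) ((LinearMap.adjoint T ∘ₗ T) x) =
      T.singularValues i ^ 2 * inner ℝ (e i) x := by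
    rw [← T.isSymmetric_adjoint_comp_self, he, LinearMap.IsSymmetric.apply_eigenvectorBasis,
      inner_smul_left, T.sq_singularValues_fin rfl i]
    rfl
  rw [h2, real_inner_comm]
  ring

theorem norm_apply_le_singularValues_zero (T : E →ₗ[ℝ] F) (x : E) :
    ‖T x‖ ≤ T.singularValues 0 * ‖x‖ := by
  refine le_of_sq_le_sq ?_ (mul_nonneg (T.singularValues_nonneg 0) (norm_nonneg _))
  rw [norm_sq_eq_sum_singularValues, mul_pow,
    ← (T.isSymmetric_adjoint_comp_self.eigenvectorBasis rfl).sum_sq_norm_inner_right x,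
    Finset.mul_sum]
  refine Finset.sum_le_sum fun i _ => ?_
  rw [Real.norm_eq_abs, sq_abs]
  refine mul_le_mul_of_nonneg_right ?_ (sq_nonneg _)
  exact pow_le_pow_left₀ (T.singularValues_nonneg _) (T.singularValues_antitone (Nat.zero_le _)) 2

/-- On the orthogonal complement of its kernel a map is bounded below by its last nonzero singular
value. -/
theorem singularValues_mul_norm_le (T : E →ₗ[ℝ] F) {x : E} (hx : x ∈ (LinearMap.ker T)ᗮ) :
    T.singularValues (Module.finrank ℝ T.range - 1) * ‖x‖ ≤ ‖T x‖ := by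
  set e := T.isSymmetric_adjoint_comp_self.eigenvectorBasis rfl with he
  refine le_of_sq_le_sq ?_ (norm_nonneg _)
  rw [norm_sq_eq_sum_singularValues, mul_pow, ← e.sum_sq_norm_inner_right x, Finset.mul_sum]
  refine Finset.sum_le_sum fun i _ => ?_
  rw [Real.norm_eq_abs, sq_abs]
  by_cases hi : (i : ℕ) < Module.finrank ℝ T.range
  · refine mul_le_mul_of_nonneg_right ?_ (sq_nonneg _)
    exact pow_le_pow_left₀ (T.singularValues_nonneg _)
      (T.singularValues_antitone (by omega)) 2
  -- Beyond the rank the eigenvectors lie in the kernel, to which `x` is orthogonal, so these terms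
  -- vanish.
  · have hσ : T.singularValues i = 0 :=
      T.singularValues_eq_zero_iff_le_finrank_range.2 (not_lt.1 hi)
    have hker : e i ∈ LinearMap.ker T := by
      have h1 : ‖T (e i)‖ ^ 2 = inner ℝ (e i) ((LinearMap.adjoint T ∘ₗ T) (e i)) := by
        rw [LinearMap.comp_apply, LinearMap.adjoint_inner_right, real_inner_self_eq_norm_sq]
      rw [he, LinearMap.IsSymmetric.apply_eigenvectorBasis, ← T.sq_singularValues_fin rfl i, hσ]
        at h1
      rw [LinearMap.mem_ker]
      simpa using h1
    rw [hx _ hker]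
    simp

/-- A surjective map `T : E → F` has adjoint bounded below by the singular value number `dim F`. -/
theorem singularValues_mul_norm_le_adjoint (T : E →ₗ[ℝ] F) (hT : Function.Surjective T) (y : F) :
    T.singularValues (Module.finrank ℝ F - 1) * ‖y‖ ≤ ‖LinearMap.adjoint T y‖ := by
  have hr : Module.finrank ℝ T.range = Module.finrank ℝ F := by
    rw [LinearMap.range_eq_top.2 hT, finrank_top]
  obtain ⟨x, hx⟩ := hT y
  obtain ⟨u, hu, w, hw, rfl⟩ := (LinearMap.ker T).exists_add_mem_mem_orthogonal x
  have hTw : T w = y := by rw [← hx, map_add, LinearMap.mem_ker.1 hu, zero_add]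
  have h1 := singularValues_mul_norm_le T hw
  rw [hr, hTw] at h1
  -- `w` is the preimage of `y` orthogonal to the kernel, and `‖y‖² = ⟪T w, y⟫ = ⟪w, T* y⟫`.
  have h2 : ‖y‖ ^ 2 ≤ ‖LinearMap.adjoint T y‖ * ‖w‖ := by
    rw [← real_inner_self_eq_norm_sq]
    conv_lhs => rw [← hTw, ← LinearMap.adjoint_inner_right, real_inner_comm, hTw]
    exact real_inner_le_norm _ _
  rcases (norm_nonneg y).eq_or_lt with h0 | h0
  · rw [← h0]; simp
  · have hw0 : 0 < ‖w‖ := by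
      refine norm_pos_iff.2 fun h => ?_
      rw [h, map_zero] at hTw
      rw [← hTw, norm_zero] at h0
      exact lt_irrefl _ h0
    refine le_of_mul_le_mul_right ?_ hw0
    calc _ = T.singularValues (Module.finrank ℝ F - 1) * ‖w‖ * ‖y‖ := by ring
      _ ≤ ‖y‖ * ‖y‖ := by gcongr
      _ ≤ _ := by rw [← sq]; exact h2

end SingularValues

/-! ### Quadratic form estimates and the saddle matrix inequality -/

section SymmetricForms

variable {X : Type*} [NormedAddCommGroup X] [InnerProductSpace ℝ X]

/-- Polarization and the parallelogram law bound `4 ⟪w, T v⟫` by `2 L (‖v‖² + ‖w‖²)`; the choice `w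
= T v / L` then gives the operator bound without spectral theory. -/
theorem norm_apply_le_of_abs_inner_le {T : X →ₗ[ℝ] X} (hT : T.IsSymmetric) {L : ℝ} (hL : 0 < L)
    (h : ∀ v, |inner ℝ v (T v)| ≤ L * ‖v‖ ^ 2) (v : X) : ‖T v‖ ≤ L * ‖v‖ := by
  set w := (1 / L) • T v with hw
  have h1 : 4 * inner ℝ w (T v) = inner ℝ (v + w) (T (v + w)) - inner ℝ (v - w) (T (v - w)) := by
    have : inner ℝ v (T w) = inner ℝ w (T v) := by rw [← hT, real_inner_comm]
    simp only [map_add, map_sub, inner_add_left, inner_add_right, inner_sub_left, inner_sub_right,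
      this]
    ring
  have h2 := (abs_le.1 (h (v + w))).2
  have h3 := (abs_le.1 (h (v - w))).1
  have h4 := parallelogram_law_with_norm ℝ v w
  have h5 : inner ℝ w (T v) = (1 / L) * ‖T v‖ ^ 2 := by
    rw [hw, inner_smul_left, real_inner_self_eq_norm_sq]; rfl
  have h6 : ‖w‖ ^ 2 = (1 / L) ^ 2 * ‖T v‖ ^ 2 := by
    rw [hw, norm_smul, mul_pow, Real.norm_of_nonneg (by positivity)]
  refine le_of_sq_le_sq ?_ (by positivity)
  have h7 : 4 * ((1 / L) * ‖T v‖ ^ 2) ≤ 2 * L * (‖v‖ ^ 2 + (1 / L) ^ 2 * ‖T v‖ ^ 2) := by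
    rw [← h5, ← h6, h1]
    nlinarith
  have h8 : 4 * ((1 / L) * ‖T v‖ ^ 2) * L = 4 * ‖T v‖ ^ 2 := by field_simp
  have h9 : 2 * L * (‖v‖ ^ 2 + (1 / L) ^ 2 * ‖T v‖ ^ 2) * L =
      2 * (L * ‖v‖) ^ 2 + 2 * ‖T v‖ ^ 2 := by field_simp
  have := mul_le_mul_of_nonneg_right h7 hL.le
  rw [h8, h9] at this
  linarith

theorem norm_apply_le_of_bounds {T : X →ₗ[ℝ] X} (hT : T.IsSymmetric) {l L : ℝ} (hl : 0 ≤ l)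
    (hL : 0 < L) (hlow : ∀ v, l * ‖v‖ ^ 2 ≤ inner ℝ v (T v))
    (hup : ∀ v, inner ℝ v (T v) ≤ L * ‖v‖ ^ 2) (v : X) : ‖T v‖ ≤ L * ‖v‖ := by
  refine norm_apply_le_of_abs_inner_le hT hL (fun v => abs_le.2 ⟨?_, hup v⟩) v
  have := hlow v
  nlinarith [mul_nonneg hl (sq_nonneg ‖v‖), mul_nonneg hL.le (sq_nonneg ‖v‖)]

/-- Co-coercivity of a symmetric positive semidefinite map bounded by `L`. -/
theorem norm_sq_apply_le_mul_inner {T : X →ₗ[ℝ] X} (hT : T.IsSymmetric) {L : ℝ}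
    (hL : 0 < L) (hlow : ∀ v, 0 ≤ inner ℝ v (T v))
    (hup : ∀ v, inner ℝ v (T v) ≤ L * ‖v‖ ^ 2) (v : X) : ‖T v‖ ^ 2 ≤ L * inner ℝ v (T v) := by
  -- Expanding gives `0 ≤ L² ⟪v, T v⟫ - 2 L ‖T v‖² + ⟪T v, T (T v)⟫`, and the upper bound at `T v`
  -- cancels one `L ‖T v‖²`.
  have h1 := hlow (L • v - T v)
  have h2 := hup (T v)
  have h3 : inner ℝ v (T (T v)) = ‖T v‖ ^ 2 := by rw [← hT, real_inner_self_eq_norm_sq]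
  simp only [map_sub, map_smul, inner_sub_left, inner_sub_right, inner_smul_left,
    inner_smul_right, h3, real_inner_self_eq_norm_sq, conj_trivial] at h1
  nlinarith

theorem mul_norm_le_norm_apply {T : X →ₗ[ℝ] X} {l : ℝ}
    (hlow : ∀ v, l * ‖v‖ ^ 2 ≤ inner ℝ v (T v)) (v : X) : l * ‖v‖ ≤ ‖T v‖ := by
  have h1 := (hlow v).trans (real_inner_le_norm _ _)
  rcases (norm_nonneg v).eq_or_lt with h | h
  · rw [← h]; simp
  · exact le_of_mul_le_mul_left (by linarith) h

variable {Y : Type*} [NormedAddCommGroup Y] [InnerProductSpace ℝ Y]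

/-- The linear matrix inequality `P J + Jᵀ P ≤ -2 c P` for the saddle matrix
`J = [-H, -Aᵀ; A, 0]` and `P = [I, α Aᵀ; α A, I]`, as an inequality of quadratic forms. -/
theorem saddle_form_le {H : X →ₗ[ℝ] X} (hH : H.IsSymmetric) {l L s m α c : ℝ}
    (hs : 0 < s) (hm : 0 < m) (hα : 0 < α) (hc0 : 0 ≤ c)
    (hlow : ∀ v, l * ‖v‖ ^ 2 ≤ inner ℝ v (H v))
    (hup : ∀ v, inner ℝ v (H v) ≤ L * ‖v‖ ^ 2) (hL : 0 < L)
    (hαl : α * (s ^ 2 + 3 / 4 * s * m ^ 2 + L ^ 2) ≤ l)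
    (hc1 : c ≤ α * (3 / 4) * (s * m ^ 2)) (hc2 : c ≤ α * (3 / 4) * m ^ 2)
    {A : X →ₗ[ℝ] Y} {B : Y →ₗ[ℝ] X} (hAB : ∀ x y, inner ℝ (A x) y = inner ℝ x (B y))
    (hA : ∀ x, ‖A x‖ ≤ s * ‖x‖) (hB : ∀ y, m * ‖y‖ ≤ ‖B y‖) (x : X) (y : Y) :
    inner ℝ x (-H x - B y + α • B (A x)) + inner ℝ y (α • A (-H x - B y) + A x) ≤
      -c * (‖x‖ ^ 2 + ‖y‖ ^ 2 + 2 * α * inner ℝ (A x) y) := by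
  have e1 : inner ℝ x (-H x - B y + α • B (A x)) + inner ℝ y (α • A (-H x - B y) + A x) =
      -inner ℝ x (H x) + α * ‖A x‖ ^ 2 - α * inner ℝ (B y) (H x) - α * ‖B y‖ ^ 2 := by
    have a1 : inner ℝ x (B (A x)) = ‖A x‖ ^ 2 := by rw [← hAB, real_inner_self_eq_norm_sq]
    have a2 : inner ℝ y (A (H x)) = inner ℝ (B y) (H x) := by
      rw [real_inner_comm, hAB, real_inner_comm]
    have a3 : inner ℝ y (A (B y)) = ‖B y‖ ^ 2 := by
      rw [real_inner_comm, hAB, real_inner_self_eq_norm_sq]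
    have a4 : inner ℝ y (A x) = inner ℝ x (B y) := by rw [real_inner_comm, hAB]
    simp only [map_sub, map_neg, inner_add_right, inner_sub_right, inner_neg_right,
      inner_smul_right, a1, a2, a3, a4]
    ring
  -- The shift absorbs the off-diagonal part of `c P`: both cross terms combine to `-α ⟪B y, u⟫`.
  set u := H x - (2 * c) • x with hu
  have hul : ‖u‖ ≤ L * ‖x‖ := by
    rcases eq_or_ne x 0 with rfl | hx
    · simp [hu]
    have hx2 : 0 < ‖x‖ ^ 2 := by have := norm_pos_iff.2 hx; positivity
    have hlL : l ≤ L := le_of_mul_le_mul_right ((hlow x).trans (hup x)) hx2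
    -- With `c ≤ l ≤ L`, the form of `H - 2 c` lies between `-L` and `L`, so the shift does not
    -- worsen the bound `L`.
    have hcl : c ≤ l := by nlinarith [mul_pos hα (pow_pos hs 2), mul_pos hα (pow_pos hL 2)]
    let T : X →ₗ[ℝ] X := H - (2 * c) • LinearMap.id
    have hT : T.IsSymmetric := by
      intro v w
      simp only [T, LinearMap.sub_apply, LinearMap.smul_apply, LinearMap.id_apply, inner_sub_left,
        inner_sub_right, inner_smul_left, inner_smul_right, conj_trivial, hH v w]
    refine norm_apply_le_of_abs_inner_le hT hL (fun v => ?_) x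
    have : inner ℝ v (T v) = inner ℝ v (H v) - 2 * c * ‖v‖ ^ 2 := by
      simp only [T, LinearMap.sub_apply, LinearMap.smul_apply, LinearMap.id_apply,
        inner_sub_right, inner_smul_right, real_inner_self_eq_norm_sq]
    rw [this, abs_le]
    have b1 := hlow v
    have b2 := hup v
    constructor
    · nlinarith [sq_nonneg ‖v‖]
    · nlinarith [mul_nonneg hc0 (sq_nonneg ‖v‖)]
  have hu2 : ‖u‖ ^ 2 ≤ L ^ 2 * ‖x‖ ^ 2 := by
    rw [← mul_pow]; exact pow_le_pow_left₀ (norm_nonneg _) hul 2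
  have hA2 : ‖A x‖ ^ 2 ≤ s ^ 2 * ‖x‖ ^ 2 := by
    rw [← mul_pow]; exact pow_le_pow_left₀ (norm_nonneg _) (hA x) 2
  have hB2 : m ^ 2 * ‖y‖ ^ 2 ≤ ‖B y‖ ^ 2 := by
    rw [← mul_pow]; exact pow_le_pow_left₀ (by positivity) (hB y) 2
  have hcy : c * ‖y‖ ^ 2 ≤ α * (3 / 4) * ‖B y‖ ^ 2 := by
    calc c * ‖y‖ ^ 2 ≤ α * (3 / 4) * m ^ 2 * ‖y‖ ^ 2 := by gcongr
      _ = α * (3 / 4) * (m ^ 2 * ‖y‖ ^ 2) := by ring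
      _ ≤ _ := by gcongr
  -- Completing the square spends `‖B y‖² / 4`; this is the origin of the `3/4` in the rate.
  have hsq : 0 ≤ inner ℝ (B y) u + ‖B y‖ ^ 2 / 4 + ‖u‖ ^ 2 := by
    have := sq_nonneg ‖(1 / 2 : ℝ) • B y + u‖
    rw [norm_add_sq_real, norm_smul, inner_smul_left, mul_pow] at this
    norm_num at this
    linarith
  have hwu : inner ℝ (B y) u = inner ℝ (B y) (H x) - 2 * c * inner ℝ (A x) y := by
    rw [hu, inner_sub_right, inner_smul_right, hAB, real_inner_comm x]
  have hsqα := mul_nonneg hα.le hsq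
  rw [hwu] at hsqα
  rw [e1]
  have f1 := mul_le_mul_of_nonneg_left hu2 hα.le
  have f2 := mul_le_mul_of_nonneg_left hA2 hα.le
  have f3 : (α * s ^ 2 + c + α * L ^ 2) * ‖x‖ ^ 2 ≤ l * ‖x‖ ^ 2 := by
    gcongr
    nlinarith
  have f4 := hlow x
  nlinarith

end SymmetricForms

/-! ### Increments of a map through its averaged derivative -/

section AveragedDerivative

variable {X : Type*} [NormedAddCommGroup X] [InnerProductSpace ℝ X] [CompleteSpace X]

/-- The average of a symmetric derivative along a segment represents the increment and inherits
quadratic form bounds. -/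
theorem exists_symmetric_map_sub_eq {g : X → X} (hg : ContDiff ℝ 1 g)
    (hsymm : ∀ x, (fderiv ℝ g x : X →ₗ[ℝ] X).IsSymmetric) {l L : ℝ}
    (hlow : ∀ x v, l * ‖v‖ ^ 2 ≤ inner ℝ v (fderiv ℝ g x v))
    (hup : ∀ x v, inner ℝ v (fderiv ℝ g x v) ≤ L * ‖v‖ ^ 2) (x y : X) :
    ∃ H : X →ₗ[ℝ] X, H.IsSymmetric ∧ (∀ v, l * ‖v‖ ^ 2 ≤ inner ℝ v (H v)) ∧
      (∀ v, inner ℝ v (H v) ≤ L * ‖v‖ ^ 2) ∧ H (x - y) = g x - g y := by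
  let D : ℝ → X →L[ℝ] X := fun τ => fderiv ℝ g (y + τ • (x - y))
  have hD : Continuous D := (hg.continuous_fderiv one_ne_zero).comp (by fun_prop)
  let H : X →L[ℝ] X := ∫ τ in (0 : ℝ)..1, D τ
  have hHv : ∀ v, H v = ∫ τ in (0 : ℝ)..1, D τ v := fun v =>
    ContinuousLinearMap.intervalIntegral_apply (hD.intervalIntegrable _ _) v
  have hDv : ∀ v, Continuous fun τ => D τ v := fun v => hD.clm_apply continuous_const
  have hin : ∀ w v, inner ℝ w (H v) = ∫ τ in (0 : ℝ)..1, inner ℝ w (D τ v) := by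
    intro w v
    rw [hHv]
    exact ((innerSL ℝ w).intervalIntegral_comp_comm ((hDv v).intervalIntegrable _ _)).symm
  have hinc : ∀ w v, Continuous fun τ => inner ℝ w (D τ v) := fun w v =>
    continuous_const.inner (hDv v)
  refine ⟨H, fun v w => ?_, fun v => ?_, fun v => ?_, ?_⟩
  · change inner ℝ (H v) w = inner ℝ v (H w)
    rw [real_inner_comm, hin, hin]
    refine intervalIntegral.integral_congr fun τ _ => ?_
    rw [real_inner_comm]
    exact hsymm _ v w
  · change _ ≤ inner ℝ v (H v)
    rw [hin]
    have := intervalIntegral.integral_mono_on (a := 0) (b := 1) (μ := MeasureTheory.volume)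
      (f := fun _ => l * ‖v‖ ^ 2)
      zero_le_one (continuous_const.intervalIntegrable _ _)
      ((hinc v v).intervalIntegrable _ _) fun τ _ => hlow _ v
    simpa using this
  · change inner ℝ v (H v) ≤ _
    rw [hin]
    have := intervalIntegral.integral_mono_on (a := 0) (b := 1) (μ := MeasureTheory.volume)
      (g := fun _ => L * ‖v‖ ^ 2)
      zero_le_one ((hinc v v).intervalIntegrable _ _)
      (continuous_const.intervalIntegrable _ _) fun τ _ => hup _ v
    simpa using this
  · change H (x - y) = _
    rw [hHv]
    have hder : ∀ τ ∈ uIcc (0 : ℝ) 1,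
        HasDerivAt (fun τ : ℝ => g (y + τ • (x - y))) (D τ (x - y)) τ := by
      intro τ _
      have h1 : HasDerivAt (fun τ : ℝ => y + τ • (x - y)) (x - y) τ := by
        simpa using ((hasDerivAt_id τ).smul_const (x - y)).const_add y
      exact ((hg.differentiable one_ne_zero _).hasFDerivAt).comp_hasDerivAt τ h1
    rw [intervalIntegral.integral_eq_sub_of_hasDerivAt hder
      ((hDv _).intervalIntegrable _ _)]
    simp

end AveragedDerivative

/-! ### Matrices on Euclidean space and their singular values -/

section Euclidean

variable {m n : ℕ}

/-- `mulE` as a continuous linear map. -/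
def mulL (M : Matrix (Fin m) (Fin n) ℝ) : EuclideanSpace ℝ (Fin n) →L[ℝ]
    EuclideanSpace ℝ (Fin m) :=
  LinearMap.toContinuousLinearMap (Matrix.toEuclideanLin M)

theorem mulL_apply (M : Matrix (Fin m) (Fin n) ℝ) (x : EuclideanSpace ℝ (Fin n)) :
    mulL M x = mulE M x := rfl

theorem inner_mulE (M : Matrix (Fin m) (Fin n) ℝ) (x : EuclideanSpace ℝ (Fin n))
    (y : EuclideanSpace ℝ (Fin m)) : inner ℝ (mulE M x) y = inner ℝ x (mulE Mᵀ y) := by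
  simp only [mulE, EuclideanSpace.inner_eq_star_dotProduct, star_trivial]
  rw [Matrix.dotProduct_mulVec, Matrix.mulVec_transpose, dotProduct_comm]

theorem adjoint_toEuclideanLin (M : Matrix (Fin m) (Fin n) ℝ) :
    LinearMap.adjoint (Matrix.toEuclideanLin M) = Matrix.toEuclideanLin Mᵀ := by
  symm
  rw [LinearMap.eq_adjoint_iff]
  intro x y
  rw [real_inner_comm, real_inner_comm _ x]
  exact (inner_mulE M y x).symm

theorem norm_mulE_le (M : Matrix (Fin m) (Fin n) ℝ) (x : EuclideanSpace ℝ (Fin n)) :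
    ‖mulE M x‖ ≤ sigmaMax M * ‖x‖ :=
  norm_apply_le_singularValues_zero (Matrix.toEuclideanLin M) x

theorem finrank_range_toEuclideanLin (M : Matrix (Fin m) (Fin n) ℝ) :
    Module.finrank ℝ (Matrix.toEuclideanLin M).range = M.rank := by
  rw [Matrix.toEuclideanLin_eq_toLin_orthonormal,
    M.rank_eq_finrank_range_toLin (EuclideanSpace.basisFun _ _).toBasis
      (EuclideanSpace.basisFun _ _).toBasis]

theorem sigmaMax_pos {M : Matrix (Fin m) (Fin n) ℝ} (h : 0 < M.rank) : 0 < sigmaMax M := by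
  rw [sigmaMax, LinearMap.singularValues_pos_iff_lt_finrank_range, finrank_range_toEuclideanLin]
  exact h

theorem sigmaMin_pos {M : Matrix (Fin m) (Fin n) ℝ} (hm : 0 < m) (h : M.rank = m) :
    0 < sigmaMin M := by
  rw [sigmaMin, LinearMap.singularValues_pos_iff_lt_finrank_range, finrank_range_toEuclideanLin]
  omega

theorem sigmaMin_mul_norm_le {M : Matrix (Fin m) (Fin n) ℝ} (h : M.rank = m)
    (y : EuclideanSpace ℝ (Fin m)) : sigmaMin M * ‖y‖ ≤ ‖mulE Mᵀ y‖ := by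
  -- Full row rank forces `m ≤ n`, so the index `min m n - 1` is `m - 1`, the last nonzero singular
  -- value.
  have hmn : m ≤ n := by
    have := M.rank_le_card_width
    rw [h, Fintype.card_fin] at this
    exact this
  have hsurj : Function.Surjective (Matrix.toEuclideanLin M) := by
    rw [← LinearMap.range_eq_top]
    refine Submodule.eq_top_of_finrank_eq ?_
    rw [finrank_range_toEuclideanLin, h, finrank_euclideanSpace_fin]
  have := singularValues_mul_norm_le_adjoint (Matrix.toEuclideanLin M) hsurj y
  rw [finrank_euclideanSpace_fin, adjoint_toEuclideanLin] at this
  rw [sigmaMin, min_eq_left hmn]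
  exact this

theorem norm_mulE_transpose_le (M : Matrix (Fin m) (Fin n) ℝ) (y : EuclideanSpace ℝ (Fin m)) :
    ‖mulE Mᵀ y‖ ≤ sigmaMax M * ‖y‖ := by
  have h1 : ‖mulE Mᵀ y‖ ^ 2 ≤ sigmaMax M * ‖mulE Mᵀ y‖ * ‖y‖ := by
    rw [← real_inner_self_eq_norm_sq, ← inner_mulE]
    refine (real_inner_le_norm _ _).trans ?_
    gcongr
    exact norm_mulE_le M _
  rcases (norm_nonneg (mulE Mᵀ y)).eq_or_lt with h | h
  · rw [← h]
    exact mul_nonneg (LinearMap.singularValues_nonneg _ _) (norm_nonneg _)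
  · refine le_of_mul_le_mul_left ?_ h
    linarith

end Euclidean

/-! ### Square root weights and the largest eigenvalue -/

section WeightedNorm

variable {ι : Type*} [Fintype ι] [DecidableEq ι]

theorem inner_sqrt_toEuclideanCLM {P : Matrix ι ι ℝ} (hP : P.PosSemidef)
    (u v : EuclideanSpace ℝ ι) :
    inner ℝ (Matrix.toEuclideanCLM (𝕜 := ℝ) (CFC.sqrt P) u)
      (Matrix.toEuclideanCLM (𝕜 := ℝ) (CFC.sqrt P) v) =
      inner ℝ u (Matrix.toEuclideanCLM (𝕜 := ℝ) P v) := by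
  set S := Matrix.toEuclideanCLM (𝕜 := ℝ) (CFC.sqrt P) with hS
  have h1 : IsSelfAdjoint S := by
    have : IsSelfAdjoint (CFC.sqrt P) := (CFC.sqrt_nonneg P).isSelfAdjoint
    rw [IsSelfAdjoint, hS, ← map_star, this.star_eq]
  have h2 : Matrix.toEuclideanCLM (𝕜 := ℝ) P = S * S := by
    rw [hS, ← map_mul, CFC.sqrt_mul_sqrt_self P hP.nonneg]
  rw [h2, mul_apply_eq_comp]
  have h3 := ContinuousLinearMap.adjoint_inner_left S (S v) u
  rwa [h1.adjoint_eq] at h3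

theorem inner_le_lambdaMax {P : Matrix ι ι ℝ} (hP : P.IsHermitian) (v : EuclideanSpace ℝ ι) :
    inner ℝ v (Matrix.toEuclideanCLM (𝕜 := ℝ) P v) ≤ lambdaMax P * ‖v‖ ^ 2 := by
  have hbdd : BddAbove (spectrum ℝ P) := by
    rw [hP.spectrum_real_eq_range_eigenvalues]
    exact (Set.finite_range _).bddAbove
  have h1 : P ≤ algebraMap ℝ (Matrix ι ι ℝ) (lambdaMax P) :=
    le_algebraMap_of_spectrum_le (fun x hx => le_csSup hbdd hx) hP
  rw [Matrix.le_iff] at h1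
  have h2 := h1.dotProduct_mulVec_nonneg v.ofLp
  rw [Matrix.sub_mulVec, Algebra.algebraMap_eq_smul_one, Matrix.smul_mulVec, Matrix.one_mulVec,
    dotProduct_sub, star_trivial, dotProduct_smul] at h2
  rw [Matrix.inner_toEuclideanCLM, ← real_inner_self_eq_norm_sq,
    EuclideanSpace.inner_eq_star_dotProduct, star_trivial]
  simpa using h2

end WeightedNorm

/-! ### The product structure of the state space -/

section State

variable {n k : ℕ}

theorem primal_stack (x : EuclideanSpace ℝ (Fin n)) (y : EuclideanSpace ℝ (Fin k)) :
    primal (stack x y) = x := rfl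

theorem dual_stack (x : EuclideanSpace ℝ (Fin n)) (y : EuclideanSpace ℝ (Fin k)) :
    dual (stack x y) = y := rfl

/-- The projection to the primal component as a continuous linear map. -/
def primalL : State n k →L[ℝ] EuclideanSpace ℝ (Fin n) :=
  LinearMap.toContinuousLinearMap
    { toFun := primal, map_add' := fun _ _ => rfl, map_smul' := fun _ _ => rfl }

/-- The projection to the dual component as a continuous linear map. -/
def dualL : State n k →L[ℝ] EuclideanSpace ℝ (Fin k) :=
  LinearMap.toContinuousLinearMap
    { toFun := dual, map_add' := fun _ _ => rfl, map_smul' := fun _ _ => rfl }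

theorem stack_add (x x' : EuclideanSpace ℝ (Fin n)) (y y' : EuclideanSpace ℝ (Fin k)) :
    stack (x + x') (y + y') = stack x y + stack x' y' := by
  ext i
  cases i <;> rfl

theorem stack_sub (x x' : EuclideanSpace ℝ (Fin n)) (y y' : EuclideanSpace ℝ (Fin k)) :
    stack (x - x') (y - y') = stack x y - stack x' y' := by
  ext i
  cases i <;> rfl

/-- Pairing as a continuous linear map. -/
def stackL : EuclideanSpace ℝ (Fin n) × EuclideanSpace ℝ (Fin k) →L[ℝ] State n k :=
  LinearMap.toContinuousLinearMap
    { toFun := fun p => stack p.1 p.2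
      map_add' := fun p q => stack_add p.1 q.1 p.2 q.2
      map_smul' := fun a p => by ext i; cases i <;> rfl }

theorem inner_state (u v : State n k) :
    inner ℝ u v = inner ℝ (primal u) (primal v) + inner ℝ (dual u) (dual v) := by
  simp only [PiLp.inner_apply, Fintype.sum_sum_type]
  rfl

theorem norm_sq_state (u : State n k) : ‖u‖ ^ 2 = ‖primal u‖ ^ 2 + ‖dual u‖ ^ 2 := by
  simp only [← real_inner_self_eq_norm_sq]
  exact inner_state u u

theorem norm_state_le (u : State n k) : ‖u‖ ≤ ‖primal u‖ + ‖dual u‖ := by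
  refine le_of_sq_le_sq ?_ (by positivity)
  rw [norm_sq_state]
  nlinarith [norm_nonneg (primal u), norm_nonneg (dual u)]

theorem norm_primal_le (u : State n k) : ‖primal u‖ ≤ ‖u‖ := by
  refine le_of_sq_le_sq ?_ (norm_nonneg _)
  rw [norm_sq_state u]
  nlinarith [sq_nonneg ‖dual u‖]

theorem norm_dual_le (u : State n k) : ‖dual u‖ ≤ ‖u‖ := by
  refine le_of_sq_le_sq ?_ (norm_nonneg _)
  rw [norm_sq_state u]
  nlinarith [sq_nonneg ‖primal u‖]

end State

/-! ### The weight matrix `P` and its norm -/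

section WeightP

variable {n k : ℕ} {A : Matrix (Fin k) (Fin n) ℝ} {linf lsup ε : ℝ}

theorem toEuclideanCLM_weightP (z : State n k) :
    Matrix.toEuclideanCLM (𝕜 := ℝ) (weightP A linf lsup ε) z =
      stack (primal z + alpha A linf lsup ε • mulE Aᵀ (dual z))
        (alpha A linf lsup ε • mulE A (primal z) + dual z) := by
  apply (WithLp.ofLp_injective 2)
  rw [Matrix.ofLp_toEuclideanCLM, weightP]
  have : z.ofLp = Sum.elim (primal z).ofLp (dual z).ofLp := by
    ext i
    cases i <;> rfl
  rw [this, Matrix.fromBlocks_mulVec]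
  simp only [Sum.elim_comp_inl, Sum.elim_comp_inr, Matrix.one_mulVec, Matrix.smul_mulVec]
  rfl

theorem inner_weightP (u v : State n k) :
    inner ℝ u (Matrix.toEuclideanCLM (𝕜 := ℝ) (weightP A linf lsup ε) v) =
      inner ℝ (primal u) (primal v + alpha A linf lsup ε • mulE Aᵀ (dual v)) +
      inner ℝ (dual u) (alpha A linf lsup ε • mulE A (primal v) + dual v) := by
  rw [toEuclideanCLM_weightP, inner_state, primal_stack, dual_stack]

theorem inner_weightP_self (u : State n k) :
    inner ℝ u (Matrix.toEuclideanCLM (𝕜 := ℝ) (weightP A linf lsup ε) u) =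
      ‖primal u‖ ^ 2 + ‖dual u‖ ^ 2 +
        2 * alpha A linf lsup ε * inner ℝ (mulE A (primal u)) (dual u) := by
  rw [inner_weightP, inner_add_right, inner_add_right, inner_smul_right, inner_smul_right,
    ← inner_mulE, real_inner_comm (mulE A (primal u)) (dual u), real_inner_self_eq_norm_sq,
    real_inner_self_eq_norm_sq]
  ring

theorem alpha_pos (hs : 0 < sigmaMax A) (hlinf : 0 < linf) (hlsup : 0 < lsup) (hε : 0 < ε) :
    0 < alpha A linf lsup ε := by
  unfold alpha
  positivity

theorem alpha_mul_eq (hs : 0 < sigmaMax A) (hlsup : 0 < lsup) :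
    alpha A linf lsup ε *
      (sigmaMax A ^ 2 + 3 / 4 * sigmaMax A * sigmaMin A ^ 2 + lsup ^ 2) = ε * linf := by
  unfold alpha
  have : sigmaMax A ^ 2 + 3 / 4 * sigmaMax A * sigmaMin A ^ 2 + lsup ^ 2 ≠ 0 := by positivity
  field_simp

/-- `ε ℓ_inf σ_max ≤ ℓ_sup σ_max ≤ (σ_max² + ℓ_sup²) / 2`, and the denominator of `α` contains both
squares. This smallness makes `P` positive definite. -/
theorem alpha_mul_sigmaMax_le (hs : 0 < sigmaMax A) (hlinf : 0 < linf) (hle : linf ≤ lsup)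
    (hε₁ : ε < 1) : alpha A linf lsup ε * sigmaMax A ≤ 1 / 2 := by
  have hlsup := hlinf.trans_le hle
  unfold alpha
  rw [div_mul_eq_mul_div, div_le_iff₀ (by positivity)]
  have h1 : ε * linf ≤ lsup := by nlinarith
  have h2 : 0 ≤ 3 / 4 * sigmaMax A * sigmaMin A ^ 2 := by positivity
  nlinarith [sq_nonneg (sigmaMax A - lsup), mul_le_mul_of_nonneg_right h1 hs.le]

theorem half_norm_sq_le_inner_weightP (hs : 0 < sigmaMax A) (hlinf : 0 < linf)
    (hle : linf ≤ lsup) (hε₀ : 0 < ε) (hε₁ : ε < 1) (u : State n k) :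
    1 / 2 * ‖u‖ ^ 2 ≤
      inner ℝ u (Matrix.toEuclideanCLM (𝕜 := ℝ) (weightP A linf lsup ε) u) := by
  rw [inner_weightP_self, norm_sq_state]
  have hα := alpha_pos (A := A) hs hlinf (hlinf.trans_le hle) hε₀
  have h1 := neg_le_of_abs_le (abs_real_inner_le_norm (mulE A (primal u)) (dual u))
  have h2 : alpha A linf lsup ε * (‖mulE A (primal u)‖ * ‖dual u‖) ≤
      1 / 2 * (‖primal u‖ * ‖dual u‖) := by
    calc _ ≤ alpha A linf lsup ε * (sigmaMax A * ‖primal u‖ * ‖dual u‖) := by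
          gcongr
          exact norm_mulE_le A _
      _ = alpha A linf lsup ε * sigmaMax A * (‖primal u‖ * ‖dual u‖) := by ring
      _ ≤ _ := by
          gcongr
          exact alpha_mul_sigmaMax_le hs hlinf hle hε₁
  have h3 := mul_le_mul_of_nonneg_left h1 hα.le
  nlinarith [sq_nonneg (‖primal u‖ - ‖dual u‖)]

theorem isHermitian_weightP : (weightP A linf lsup ε).IsHermitian := by
  rw [Matrix.IsHermitian, weightP, Matrix.conjTranspose_eq_transpose_of_trivial,
    Matrix.fromBlocks_transpose]
  simp

theorem posDef_weightP (hs : 0 < sigmaMax A) (hlinf : 0 < linf)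
    (hle : linf ≤ lsup) (hε₀ : 0 < ε) (hε₁ : ε < 1) : (weightP A linf lsup ε).PosDef := by
  refine Matrix.PosDef.of_dotProduct_mulVec_pos isHermitian_weightP fun x hx => ?_
  have h1 := half_norm_sq_le_inner_weightP hs hlinf hle hε₀ hε₁ (WithLp.toLp 2 x : State n k)
  rw [Matrix.inner_toEuclideanCLM] at h1
  have h2 : (WithLp.toLp 2 x : State n k) ≠ 0 := fun h => hx (congrArg WithLp.ofLp h)
  have h3 := norm_pos_iff.2 h2
  have h4 : 0 < 1 / 2 * ‖(WithLp.toLp 2 x : State n k)‖ ^ 2 := by positivity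
  rw [star_trivial]
  exact h4.trans_le h1

/-- The square root of the weight matrix as a continuous linear map. -/
def sqrtWeight (A : Matrix (Fin k) (Fin n) ℝ) (linf lsup ε : ℝ) : State n k →L[ℝ] State n k :=
  Matrix.toEuclideanCLM (𝕜 := ℝ) (CFC.sqrt (weightP A linf lsup ε))

theorem normP_eq : normP A linf lsup ε = fun v => ‖sqrtWeight A linf lsup ε v‖ := rfl

theorem inner_sqrtWeight (hP : (weightP A linf lsup ε).PosDef) (u v : State n k) :
    inner ℝ (sqrtWeight A linf lsup ε u) (sqrtWeight A linf lsup ε v) =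
      inner ℝ u (Matrix.toEuclideanCLM (𝕜 := ℝ) (weightP A linf lsup ε) v) :=
  inner_sqrt_toEuclideanCLM hP.posSemidef u v

theorem half_mul_norm_le_sqrtWeight (hs : 0 < sigmaMax A) (hlinf : 0 < linf)
    (hle : linf ≤ lsup) (hε₀ : 0 < ε) (hε₁ : ε < 1) (u : State n k) :
    1 / 2 * ‖u‖ ≤ ‖sqrtWeight A linf lsup ε u‖ := by
  refine le_of_sq_le_sq ?_ (norm_nonneg _)
  rw [← real_inner_self_eq_norm_sq,
    inner_sqrtWeight (posDef_weightP hs hlinf hle hε₀ hε₁)]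
  have := half_norm_sq_le_inner_weightP hs hlinf hle hε₀ hε₁ u
  nlinarith [sq_nonneg ‖u‖]

/-- On vectors `(x, 0)` the form of `P` equals `‖x‖²`. -/
theorem one_le_lambdaMax (hn : 0 < n) : 1 ≤ lambdaMax (weightP A linf lsup ε) := by
  let x : EuclideanSpace ℝ (Fin n) := EuclideanSpace.single ⟨0, hn⟩ 1
  have h := inner_le_lambdaMax (isHermitian_weightP (A := A) (linf := linf) (lsup := lsup)
    (ε := ε)) (stack x 0)
  rw [inner_weightP_self, norm_sq_state, primal_stack, dual_stack] at h
  simpa [x] using h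

/-- The sharp factor is the root of `λ_max(P)`; since `λ_max(P) ≥ 1`, the eigenvalue itself
dominates it, and this is the factor in `ρ`. -/
theorem sqrtWeight_norm_le (hn : 0 < n) (hP : (weightP A linf lsup ε).PosDef) (u : State n k) :
    ‖sqrtWeight A linf lsup ε u‖ ≤ lambdaMax (weightP A linf lsup ε) * ‖u‖ := by
  have h1 := one_le_lambdaMax (A := A) (linf := linf) (lsup := lsup) (ε := ε) hn
  refine le_of_sq_le_sq ?_ (by positivity)
  rw [← real_inner_self_eq_norm_sq, inner_sqrtWeight hP]
  refine (inner_le_lambdaMax hP.isHermitian u).trans ?_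
  rw [mul_pow]
  gcongr
  nlinarith

theorem rate_pos (hs : 0 < sigmaMax A) (hm : 0 < sigmaMin A) (hlinf : 0 < linf)
    (hlsup : 0 < lsup) (hε : 0 < ε) : 0 < rate A linf lsup ε := by
  have := alpha_pos (A := A) hs hlinf hlsup hε
  unfold rate
  positivity

end WeightP

/-! ### Gradients, symmetric Hessians and convexity -/

section Gradient

variable {X : Type*} [NormedAddCommGroup X] [InnerProductSpace ℝ X] [CompleteSpace X] {φ : X → ℝ}

theorem contDiff_gradient (hφ : ContDiff ℝ 2 φ) : ContDiff ℝ 1 (gradient φ) :=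
  (InnerProductSpace.toDual ℝ X).symm.toContinuousLinearEquiv.contDiff.comp
    (hφ.fderiv_right (m := 1) (by norm_num))

theorem inner_fderiv_gradient (hφ : ContDiff ℝ 2 φ) (x v w : X) :
    inner ℝ (fderiv ℝ (gradient φ) x v) w = fderiv ℝ (fderiv ℝ φ) x v w := by
  have hd : DifferentiableAt ℝ (fderiv ℝ φ) x :=
    (hφ.fderiv_right (m := 1) (by norm_num)).differentiable one_ne_zero x
  have hg : DifferentiableAt ℝ (gradient φ) x :=
    (contDiff_gradient hφ).differentiable one_ne_zero x
  have h1 := hg.hasFDerivAt.inner ℝ (hasFDerivAt_const w x)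
  have h2 := hd.hasFDerivAt.clm_apply (hasFDerivAt_const w x)
  have h3 : (fun y => inner ℝ (gradient φ y) w) = fun y => fderiv ℝ φ y w :=
    funext fun y => inner_gradient_left
  rw [h3] at h1
  simpa using congrArg (fun T : X →L[ℝ] ℝ => T v) (h1.unique h2)

theorem isSymmetric_fderiv_gradient (hφ : ContDiff ℝ 2 φ) (x : X) :
    (fderiv ℝ (gradient φ) x : X →ₗ[ℝ] X).IsSymmetric := by
  intro v w
  have hs : IsSymmSndFDerivAt ℝ φ x := hφ.contDiffAt.isSymmSndFDerivAt (by simp)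
  change inner ℝ (fderiv ℝ (gradient φ) x v) w = inner ℝ v (fderiv ℝ (gradient φ) x w)
  rw [← real_inner_comm v, inner_fderiv_gradient hφ, inner_fderiv_gradient hφ]
  exact hs v w

/-- First-order characterization of convexity. -/
theorem add_inner_gradient_le (hφ : ContDiff ℝ 2 φ)
    (hmono : ∀ x y, 0 ≤ inner ℝ (gradient φ x - gradient φ y) (x - y)) (x y : X) :
    φ x + inner ℝ (gradient φ x) (y - x) ≤ φ y := by
  have hder : ∀ τ : ℝ, HasDerivAt (fun τ : ℝ => φ (x + τ • (y - x)))
      (inner ℝ (gradient φ (x + τ • (y - x))) (y - x)) τ := by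
    intro τ
    have h1 : HasDerivAt (fun τ : ℝ => x + τ • (y - x)) (y - x) τ := by
      simpa using ((hasDerivAt_id τ).smul_const (y - x)).const_add x
    have h2 := ((hφ.differentiable two_ne_zero (x + τ • (y - x))).hasFDerivAt).comp_hasDerivAt τ h1
    rwa [← inner_gradient_left] at h2
  -- The secant slope is the slope at some `ξ > 0`, which by monotonicity of the gradient is at
  -- least the slope at `0`.
  obtain ⟨ξ, hξ, hξ'⟩ := exists_hasDerivAt_eq_slope (fun τ : ℝ => φ (x + τ • (y - x))) _
    zero_lt_one (fun τ _ => (hder τ).continuousAt.continuousWithinAt) (fun τ _ => hder τ)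
  simp only [one_smul, zero_smul, add_zero, sub_zero, div_one, add_sub_cancel] at hξ'
  have h3 := hmono (x + ξ • (y - x)) x
  rw [add_sub_cancel_left, inner_smul_right, inner_sub_left] at h3
  have h4 := nonneg_of_mul_nonneg_right h3 hξ.1
  linarith

end Gradient

/-! ### Sensitivity of linear saddle point systems -/

section Sensitivity

variable {X Y : Type*} [NormedAddCommGroup X] [InnerProductSpace ℝ X] [FiniteDimensional ℝ X]
  [NormedAddCommGroup Y] [InnerProductSpace ℝ Y]

/-- Sensitivity of the solution of a linear saddle point system to its data. -/
theorem saddle_sensitivity {H : X →ₗ[ℝ] X} (hH : H.IsSymmetric) {l L s m : ℝ}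
    (hl : 0 < l) (hL : 0 < L) (hs : 0 ≤ s) (hm : 0 < m)
    (hlow : ∀ v, l * ‖v‖ ^ 2 ≤ inner ℝ v (H v))
    (hup : ∀ v, inner ℝ v (H v) ≤ L * ‖v‖ ^ 2)
    {A : X →ₗ[ℝ] Y} {B : Y →ₗ[ℝ] X} (hAB : ∀ x y, inner ℝ (A x) y = inner ℝ x (B y))
    (hA : ∀ x, ‖A x‖ ≤ s * ‖x‖) (hB : ∀ y, m * ‖y‖ ≤ ‖B y‖) (hB' : ∀ y, ‖B y‖ ≤ s * ‖y‖)
    {d e : X} {ν : Y} (hd : H d = -B ν - e) :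
    ‖ν‖ ≤ L / m ^ 2 * (‖A d‖ + s / l * ‖e‖) ∧ ‖d‖ ≤ ‖e‖ / l + s / l * ‖ν‖ := by
  have hexp := mul_norm_le_norm_apply hlow
  have hinj : Function.Injective H := by
    rw [injective_iff_map_eq_zero]
    intro v hv
    have h1 := hexp v
    rw [hv, norm_zero] at h1
    exact norm_le_zero_iff.1 (nonpos_of_mul_nonpos_right h1 hl)
  -- Shifting `d` by `H⁻¹ e` makes the system homogeneous, `H (d + e') = -B ν`. Co-coercivity then
  -- bounds `‖B ν‖²` by `L ‖A (d + e')‖ ‖ν‖`.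
  obtain ⟨e', he'⟩ := (LinearMap.injective_iff_surjective.1 hinj) e
  have hHw : H (d + e') = -B ν := by rw [map_add, hd, he', sub_add_cancel]
  have he'n : ‖e'‖ ≤ ‖e‖ / l := by
    rw [le_div_iff₀ hl, mul_comm, ← he']
    exact hexp e'
  constructor
  · have h1 := norm_sq_apply_le_mul_inner hH hL
      (fun v => (mul_nonneg hl.le (sq_nonneg _)).trans (hlow v)) hup (d + e')
    rw [hHw, norm_neg, inner_neg_right, ← hAB] at h1
    have h2 : -inner ℝ (A (d + e')) ν ≤ ‖A (d + e')‖ * ‖ν‖ :=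
      neg_le_of_neg_le (neg_le_of_abs_le (abs_real_inner_le_norm _ _))
    have h3 : ‖A (d + e')‖ ≤ ‖A d‖ + s / l * ‖e‖ := by
      rw [map_add]
      refine (norm_add_le _ _).trans ?_
      have := (hA e').trans (mul_le_mul_of_nonneg_left he'n hs)
      rw [mul_div_left_comm, mul_comm] at this
      linarith
    have h4 : m ^ 2 * ‖ν‖ ^ 2 ≤ ‖B ν‖ ^ 2 := by
      rw [← mul_pow]; exact pow_le_pow_left₀ (by positivity) (hB ν) 2
    rcases (norm_nonneg ν).eq_or_lt with h0 | h0
    · rw [← h0]; positivity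
    · rw [div_mul_eq_mul_div, le_div_iff₀ (by positivity)]
      refine le_of_mul_le_mul_right ?_ h0
      calc ‖ν‖ * m ^ 2 * ‖ν‖ = m ^ 2 * ‖ν‖ ^ 2 := by ring
        _ ≤ L * (‖A (d + e')‖ * ‖ν‖) :=
          h4.trans (h1.trans (mul_le_mul_of_nonneg_left h2 hL.le))
        _ ≤ L * ((‖A d‖ + s / l * ‖e‖) * ‖ν‖) := by gcongr
        _ = _ := by ring
  · have h1 := hexp d
    rw [hd] at h1
    have h2 : ‖-B ν - e‖ ≤ s * ‖ν‖ + ‖e‖ := by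
      refine (norm_sub_le _ _).trans ?_
      rw [norm_neg]
      gcongr
      exact hB' ν
    have h3 : ‖e‖ / l + s / l * ‖ν‖ = (s * ‖ν‖ + ‖e‖) / l := by ring
    rw [h3, le_div_iff₀ hl]
    linarith

end Sensitivity

/-! ### The primal-dual field: dissipativity and motion of the optimizer -/

section Problem

variable {n k : ℕ} {A : Matrix (Fin k) (Fin n) ℝ} {b : ℝ → EuclideanSpace ℝ (Fin k)}
  {f : EuclideanSpace ℝ (Fin n) → ℝ → ℝ} {linf lsup ε : ℝ}

/-- Smoothness and uniform convexity of the cost at a fixed time. -/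
structure IsRegularAt (f : EuclideanSpace ℝ (Fin n) → ℝ → ℝ) (linf lsup t : ℝ) : Prop where
  contDiff : ContDiff ℝ 2 (fun x => f x t)
  lower : ∀ x v, linf * ‖v‖ ^ 2 ≤ inner ℝ v (hess f x t v)
  upper : ∀ x v, inner ℝ v (hess f x t v) ≤ lsup * ‖v‖ ^ 2

namespace IsRegularAt

variable {t : ℝ}

theorem exists_averaged_hess (hf : IsRegularAt f linf lsup t) (x y : EuclideanSpace ℝ (Fin n)) :
    ∃ H : EuclideanSpace ℝ (Fin n) →ₗ[ℝ] EuclideanSpace ℝ (Fin n), H.IsSymmetric ∧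
      (∀ v, linf * ‖v‖ ^ 2 ≤ inner ℝ v (H v)) ∧ (∀ v, inner ℝ v (H v) ≤ lsup * ‖v‖ ^ 2) ∧
      H (x - y) = grad f x t - grad f y t :=
  exists_symmetric_map_sub_eq (contDiff_gradient hf.contDiff)
    (isSymmetric_fderiv_gradient hf.contDiff) hf.lower hf.upper x y

theorem linf_le_lsup (hf : IsRegularAt f linf lsup t) (hn : 0 < n) : linf ≤ lsup := by
  have := (hf.lower 0 (EuclideanSpace.single ⟨0, hn⟩ 1)).trans (hf.upper 0 _)
  simpa using this

theorem add_inner_grad_le (hf : IsRegularAt f linf lsup t) (hlinf : 0 ≤ linf)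
    (x y : EuclideanSpace ℝ (Fin n)) : f x t + inner ℝ (grad f x t) (y - x) ≤ f y t := by
  refine add_inner_gradient_le hf.contDiff (fun x y => ?_) x y
  obtain ⟨H, -, hlow, -, hH⟩ := hf.exists_averaged_hess x y
  change 0 ≤ inner ℝ (grad f x t - grad f y t) (x - y)
  rw [← hH, real_inner_comm]
  exact (mul_nonneg hlinf (sq_nonneg _)).trans (hlow _)

/-- Optimizers with multipliers are the zeros of the primal-dual field. -/
theorem isOptimizer_iff (hf : IsRegularAt f linf lsup t) (hlinf : 0 ≤ linf) {z : State n k} :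
    IsOptimizer A b f t z ↔ field A b f z t = 0 := by
  have hzero : field A b f z t = 0 ↔
      -grad f (primal z) t - mulE Aᵀ (dual z) = 0 ∧ mulE A (primal z) - b t = 0 := by
    constructor
    · intro h
      exact ⟨congrArg primal h, congrArg dual h⟩
    · rintro ⟨h1, h2⟩
      rw [field, h1, h2]
      exact map_zero stackL
  rw [hzero]
  constructor
  · intro h
    refine ⟨?_, sub_eq_zero.2 h.feasible⟩
    rw [← neg_add', h.multiplier, neg_zero]
  · rintro ⟨h1, h2⟩
    have hfeas := sub_eq_zero.1 h2
    have hmult : grad f (primal z) t + mulE Aᵀ (dual z) = 0 := by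
      rw [← neg_add'] at h1
      exact neg_eq_zero.1 h1
    refine ⟨hfeas, fun y hy => ?_, hmult⟩
    have h3 := hf.add_inner_grad_le hlinf (primal z) y
    have h4 : inner ℝ (grad f (primal z) t) (y - primal z) = 0 := by
      rw [eq_neg_of_add_eq_zero_left hmult, inner_neg_left, real_inner_comm, ← inner_mulE]
      have : mulE A (y - primal z) = 0 := by
        rw [← mulL_apply, map_sub, mulL_apply, mulL_apply, hy, hfeas, sub_self]
      rw [this, inner_zero_left, neg_zero]
    linarith

end IsRegularAt

theorem inner_sqrtWeight_saddle_le (hk : 0 < k) (hA : A.rank = k)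
    (hlinf : 0 < linf) (hle : linf ≤ lsup) (hε₀ : 0 < ε) (hε₁ : ε < 1)
    {H : EuclideanSpace ℝ (Fin n) →ₗ[ℝ] EuclideanSpace ℝ (Fin n)} (hH : H.IsSymmetric)
    (hlow : ∀ v, linf * ‖v‖ ^ 2 ≤ inner ℝ v (H v))
    (hup : ∀ v, inner ℝ v (H v) ≤ lsup * ‖v‖ ^ 2) (v : State n k) :
    inner ℝ (sqrtWeight A linf lsup ε v) (sqrtWeight A linf lsup ε
      (stack (-H (primal v) - mulE Aᵀ (dual v)) (mulE A (primal v)))) ≤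
      -rate A linf lsup ε * ‖sqrtWeight A linf lsup ε v‖ ^ 2 := by
  have hs : 0 < sigmaMax A := sigmaMax_pos (hk.trans_eq hA.symm)
  have hm : 0 < sigmaMin A := sigmaMin_pos hk hA
  have hlsup := hlinf.trans_le hle
  have hα := alpha_pos (A := A) hs hlinf hlsup hε₀
  have hP := posDef_weightP (A := A) hs hlinf hle hε₀ hε₁
  rw [← real_inner_self_eq_norm_sq, inner_sqrtWeight hP, inner_sqrtWeight hP, inner_weightP_self,
    inner_weightP, primal_stack, dual_stack]
  -- The factor `σ_max / (σ_max + 1)` in the rate is below both `σ_max` and `1`, as the `x` and `ν`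
  -- estimates require respectively.
  have h1 : sigmaMax A * sigmaMin A ^ 2 / (sigmaMax A + 1) ≤ sigmaMax A * sigmaMin A ^ 2 :=
    div_le_self (by positivity) (by linarith)
  have h2 : sigmaMax A * sigmaMin A ^ 2 / (sigmaMax A + 1) ≤ sigmaMin A ^ 2 := by
    rw [div_le_iff₀ (by positivity)]
    nlinarith [sq_nonneg (sigmaMin A)]
  have h3 : alpha A linf lsup ε *
      (sigmaMax A ^ 2 + 3 / 4 * sigmaMax A * sigmaMin A ^ 2 + lsup ^ 2) ≤ linf := by
    rw [alpha_mul_eq hs hlsup]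
    nlinarith
  have hc1 : rate A linf lsup ε ≤ alpha A linf lsup ε * (3 / 4) * (sigmaMax A * sigmaMin A ^ 2) :=
    mul_le_mul_of_nonneg_left h1 (by positivity)
  have hc2 : rate A linf lsup ε ≤ alpha A linf lsup ε * (3 / 4) * sigmaMin A ^ 2 :=
    mul_le_mul_of_nonneg_left h2 (by positivity)
  exact saddle_form_le (A := (mulL A).toLinearMap) (B := (mulL Aᵀ).toLinearMap)
    hH hs hm hα (rate_pos hs hm hlinf hlsup hε₀).le hlow hup hlsup h3 hc1 hc2 (inner_mulE A)
    (norm_mulE_le A) (sigmaMin_mul_norm_le hA) (primal v) (dual v)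

/-- With the averaged Hessian, the nonlinear increment of the field is a single saddle matrix, so
the linear estimate holds globally. -/
theorem isDissipative_field (hn : 0 < n) (hk : 0 < k) (hA : A.rank = k)
    (hlinf : 0 < linf) (hε₀ : 0 < ε) (hε₁ : ε < 1)
    (hf : ∀ t, 0 ≤ t → IsRegularAt f linf lsup t)
    (hgrad : ∀ x, ContinuousOn (fun t => grad f x t) (Ici 0)) (hb : ContinuousOn b (Ici 0)) :
    IsDissipative (sqrtWeight A linf lsup ε) (field A b f) (rate A linf lsup ε)
      (lsup + sigmaMax A + sigmaMax A) (1 / 2) := by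
  have hs : 0 < sigmaMax A := sigmaMax_pos (hk.trans_eq hA.symm)
  have hm : 0 < sigmaMin A := sigmaMin_pos hk hA
  have hle := (hf 0 le_rfl).linf_le_lsup hn
  have hlsup := hlinf.trans_le hle
  have hsub : ∀ t z w, ∀ H : EuclideanSpace ℝ (Fin n) →ₗ[ℝ] EuclideanSpace ℝ (Fin n),
      H (primal z - primal w) = grad f (primal z) t - grad f (primal w) t →
      field A b f z t - field A b f w t =
        stack (-H (primal (z - w)) - mulE Aᵀ (dual (z - w))) (mulE A (primal (z - w))) := by
    intro t z w H hH
    have e1 : primal (z - w) = primal z - primal w := rfl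
    have e2 : mulE Aᵀ (dual (z - w)) = mulE Aᵀ (dual z) - mulE Aᵀ (dual w) :=
      map_sub (mulL Aᵀ) (dual z) (dual w)
    have e3 : mulE A (primal (z - w)) = mulE A (primal z) - mulE A (primal w) :=
      map_sub (mulL A) (primal z) (primal w)
    rw [e2, e3, e1, hH, field, field, ← stack_sub]
    congr 1 <;> abel
  refine ⟨rate_pos hs hm hlinf hlsup hε₀, by positivity, by norm_num,
    half_mul_norm_le_sqrtWeight hs hlinf hle hε₀ hε₁, fun t ht z w => ?_, fun t ht z w => ?_,
    fun z => ?_⟩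
  · obtain ⟨H, hH, hlow, hup, hHd⟩ := (hf t ht).exists_averaged_hess (primal z) (primal w)
    rw [hsub t z w H hHd]
    refine (norm_state_le _).trans ?_
    rw [primal_stack, dual_stack]
    have h1 := norm_apply_le_of_bounds hH hlinf.le hlsup hlow hup (primal (z - w))
    have h2 := norm_mulE_transpose_le A (dual (z - w))
    have h3 := norm_mulE_le A (primal (z - w))
    have h4 := norm_sub_le (-H (primal (z - w))) (mulE Aᵀ (dual (z - w)))
    rw [norm_neg] at h4
    have h5 := mul_le_mul_of_nonneg_left (norm_primal_le (z - w)) hlsup.le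
    have h6 := mul_le_mul_of_nonneg_left (norm_primal_le (z - w)) hs.le
    have h7 := mul_le_mul_of_nonneg_left (norm_dual_le (z - w)) hs.le
    linarith
  · obtain ⟨H, hH, hlow, hup, hHd⟩ := (hf t ht).exists_averaged_hess (primal z) (primal w)
    rw [hsub t z w H hHd]
    exact inner_sqrtWeight_saddle_le hk hA hlinf hle hε₀ hε₁ hH hlow hup (z - w)
  · exact stackL.continuous.comp_continuousOn
      ((((hgrad (primal z)).neg).sub continuousOn_const).prodMk (continuousOn_const.sub hb))

theorem IsRegularAt.hasFDerivAt_field {t : ℝ} (hf : IsRegularAt f linf lsup t) (z : State n k) :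
    HasFDerivAt (fun y => field A b f y t)
      (stackL.comp (((-(hess f (primal z) t).comp primalL) - (mulL Aᵀ).comp dualL).prod
        ((mulL A).comp primalL))) z := by
  have hg : HasFDerivAt (fun y => grad f y t) (hess f (primal z) t) (primal z) :=
    ((contDiff_gradient hf.contDiff).differentiable one_ne_zero (primal z)).hasFDerivAt
  have h1 : HasFDerivAt (fun y : State n k => grad f (primalL y) t)
      ((hess f (primal z) t).comp primalL) z := hg.comp z primalL.hasFDerivAt
  have h2 : HasFDerivAt (fun y : State n k => mulL Aᵀ (dualL y)) ((mulL Aᵀ).comp dualL) z :=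
    ((mulL Aᵀ).comp dualL).hasFDerivAt
  have h3 : HasFDerivAt (fun y : State n k => mulL A (primalL y) - b t)
      ((mulL A).comp primalL) z := ((mulL A).comp primalL).hasFDerivAt.sub_const (b t)
  exact stackL.hasFDerivAt.comp z ((h1.neg.sub h2).prodMk h3)

/-- The Jacobian is the saddle matrix with the Hessian at the point itself, so the same form
inequality applies. -/
theorem hasContractionRate_field (hn : 0 < n) (hk : 0 < k) (hA : A.rank = k)
    (hlinf : 0 < linf) (hε₀ : 0 < ε) (hε₁ : ε < 1)
    (hf : ∀ t, 0 ≤ t → IsRegularAt f linf lsup t) :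
    HasContractionRate (normP A linf lsup ε) (field A b f) (rate A linf lsup ε) := by
  have hs : 0 < sigmaMax A := sigmaMax_pos (hk.trans_eq hA.symm)
  have hle := (hf 0 le_rfl).linf_le_lsup hn
  have : Nonempty (Fin n) := ⟨⟨0, hn⟩⟩
  intro t ht z
  have hd := (hf t ht).hasFDerivAt_field (A := A) (b := b) z
  refine ⟨hd.differentiableAt, ?_⟩
  rw [hd.fderiv, normP_eq]
  refine exists_isMatrixMeasure_le one_half_pos
    (half_mul_norm_le_sqrtWeight hs hlinf hle hε₀ hε₁) _ fun v => ?_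
  exact inner_sqrtWeight_saddle_le hk hA hlinf hle hε₀ hε₁
    (isSymmetric_fderiv_gradient (hf t ht).contDiff (primal z)) ((hf t ht).lower (primal z))
    ((hf t ht).upper (primal z)) v

theorem mulE_sensitivity (hk : 0 < k) (hA : A.rank = k) (hlinf : 0 < linf) (hlsup : 0 < lsup)
    {H : EuclideanSpace ℝ (Fin n) →ₗ[ℝ] EuclideanSpace ℝ (Fin n)} (hH : H.IsSymmetric)
    (hlow : ∀ v, linf * ‖v‖ ^ 2 ≤ inner ℝ v (H v))
    (hup : ∀ v, inner ℝ v (H v) ≤ lsup * ‖v‖ ^ 2) {d e : EuclideanSpace ℝ (Fin n)}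
    {ν : EuclideanSpace ℝ (Fin k)} (hd : H d = -mulE Aᵀ ν - e) :
    ‖ν‖ ≤ lsup / sigmaMin A ^ 2 * (‖mulE A d‖ + sigmaMax A / linf * ‖e‖) ∧
      ‖d‖ ≤ ‖e‖ / linf + sigmaMax A / linf * ‖ν‖ :=
  saddle_sensitivity (A := (mulL A).toLinearMap) (B := (mulL Aᵀ).toLinearMap) hH hlinf hlsup
    (sigmaMax_pos (hk.trans_eq hA.symm)).le (sigmaMin_pos hk hA) hlow hup (inner_mulE A)
    (norm_mulE_le A) (sigmaMin_mul_norm_le hA) (norm_mulE_transpose_le A) hd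

/-- Split the gradient increment between the optima into a spatial part at time `t`, given by an
averaged Hessian, and a temporal part at the fixed point `x*(s)`. The difference of the optimality
systems is then a linear saddle system with data of size `O(|t - s|)`. -/
theorem norm_optimizer_sub_le (hk : 0 < k) (hA : A.rank = k)
    (hlinf : 0 < linf) (hlsup : 0 < lsup) (hf : ∀ t, 0 ≤ t → IsRegularAt f linf lsup t)
    (hgrad : ∀ x, ContDiffOn ℝ 1 (fun t => grad f x t) (Ici 0)) (hb : ContDiffOn ℝ 1 b (Ici 0))
    {β₁ β₂ : ℝ} (hβ₁ : ∀ t, 0 ≤ t → ‖derivWithin b (Ici 0) t‖ ≤ β₁)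
    (hβ₂ : ∀ x t, 0 ≤ t → ‖derivWithin (fun s => grad f x s) (Ici 0) t‖ ≤ β₂)
    {zstar : ℝ → State n k} (hz : ∀ t, 0 ≤ t → IsOptimizer A b f t (zstar t))
    {s t : ℝ} (hs : 0 ≤ s) (ht : 0 ≤ t) :
    ‖zstar t - zstar s‖ ≤ (β₂ / linf + (sigmaMax A / linf + 1) *
      (lsup / sigmaMin A ^ 2 * (β₁ + sigmaMax A / linf * β₂))) * |t - s| := by
  have hσ : 0 < sigmaMax A := sigmaMax_pos (hk.trans_eq hA.symm)
  have hm : 0 < sigmaMin A := sigmaMin_pos hk hA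
  have hbd : ‖b t - b s‖ ≤ β₁ * |t - s| :=
    (convex_Ici 0).norm_image_sub_le_of_norm_derivWithin_le (hb.differentiableOn one_ne_zero)
      (fun x hx => hβ₁ x hx) hs ht
  set xs := primal (zstar s)
  have hgd : ‖grad f xs t - grad f xs s‖ ≤ β₂ * |t - s| :=
    (convex_Ici 0).norm_image_sub_le_of_norm_derivWithin_le
      ((hgrad xs).differentiableOn one_ne_zero) (fun x hx => hβ₂ xs x hx) hs ht
  obtain ⟨H, hH, hlow, hup, hHd⟩ := (hf t ht).exists_averaged_hess (primal (zstar t)) xs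
  have e1 : mulE Aᵀ (dual (zstar t - zstar s)) =
      mulE Aᵀ (dual (zstar t)) - mulE Aᵀ (dual (zstar s)) :=
    map_sub (mulL Aᵀ) (dual (zstar t)) (dual (zstar s))
  have e2 : mulE A (primal (zstar t - zstar s)) = b t - b s := by
    rw [← (hz t ht).feasible, ← (hz s hs).feasible]
    exact map_sub (mulL A) (primal (zstar t)) (primal (zstar s))
  have hd : H (primal (zstar t - zstar s)) =
      -mulE Aᵀ (dual (zstar t - zstar s)) - (grad f xs t - grad f xs s) := by
    have h1 := eq_neg_of_add_eq_zero_left (hz t ht).multiplier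
    have h2 := eq_neg_of_add_eq_zero_left (hz s hs).multiplier
    have h3 : primal (zstar t - zstar s) = primal (zstar t) - xs := rfl
    rw [h3, hHd, e1, h1, h2]
    abel
  obtain ⟨h1, h2⟩ := mulE_sensitivity hk hA hlinf hlsup hH hlow hup hd
  rw [e2] at h1
  set δ := |t - s|
  have h3 : ‖dual (zstar t - zstar s)‖ ≤
      lsup / sigmaMin A ^ 2 * (β₁ * δ + sigmaMax A / linf * (β₂ * δ)) := by
    refine h1.trans ?_
    gcongr
  calc ‖zstar t - zstar s‖ ≤ _ := norm_state_le _
    _ ≤ β₂ * δ / linf + sigmaMax A / linf * (lsup / sigmaMin A ^ 2 *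
          (β₁ * δ + sigmaMax A / linf * (β₂ * δ))) +
        lsup / sigmaMin A ^ 2 * (β₁ * δ + sigmaMax A / linf * (β₂ * δ)) := by
      refine add_le_add (h2.trans ?_) h3
      gcongr
    _ = _ := by ring

end Problem

end PrimalDual

end

/-! ### Contraction and tracking of the optimizer -/

theorem theorem4 (n k : ℕ) (hk : 0 < k) (hkn : k < n)
    (A : Matrix (Fin k) (Fin n) ℝ) (hA : A.rank = k)
    (b : ℝ → EuclideanSpace ℝ (Fin k)) (f : EuclideanSpace ℝ (Fin n) → ℝ → ℝ)
    (linf lsup : ℝ) (hlinf : 0 < linf) (hlsup : 0 < lsup)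
    (hf : ∀ t : ℝ, 0 ≤ t → ContDiff ℝ 2 (fun x => f x t))
    (hconvex : ∀ t : ℝ, 0 ≤ t → ∀ x v : EuclideanSpace ℝ (Fin n),
      linf * ‖v‖ ^ 2 ≤ inner ℝ v (PrimalDual.hess f x t v))
    (hsmooth : ∀ t : ℝ, 0 ≤ t → ∀ x v : EuclideanSpace ℝ (Fin n),
      inner ℝ v (PrimalDual.hess f x t v) ≤ lsup * ‖v‖ ^ 2)
    (hgrad : ∀ x : EuclideanSpace ℝ (Fin n),
      ContDiffOn ℝ 1 (fun t => PrimalDual.grad f x t) (Set.Ici 0))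
    (hb : ContDiffOn ℝ 1 b (Set.Ici 0))
    (ε : ℝ) (hε₀ : 0 < ε) (hε₁ : ε < 1) :
    -- `P` is positive definite, and the dynamics are contractive with rate `c`
    ((PrimalDual.weightP A linf lsup ε).PosDef ∧
      PrimalDual.IsContractive (PrimalDual.normP A linf lsup ε) (PrimalDual.field A b f)
        (PrimalDual.rate A linf lsup ε) ∧
      PrimalDual.HasContractionRate (PrimalDual.normP A linf lsup ε) (PrimalDual.field A b f)
        (PrimalDual.rate A linf lsup ε)) ∧
    -- the optimizer trajectory is well defined
    (∀ t : ℝ, 0 ≤ t → ∃! z : PrimalDual.State n k, PrimalDual.IsOptimizer A b f t z) ∧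
    -- tracking bound and uniform ultimate boundedness of the tracking error
    (∀ β₁ β₂ : ℝ, 0 < β₁ → 0 < β₂ →
      (∀ t : ℝ, 0 ≤ t → ‖derivWithin b (Set.Ici 0) t‖ ≤ β₁) →
      (∀ (x : EuclideanSpace ℝ (Fin n)) (t : ℝ), 0 ≤ t →
        ‖derivWithin (fun s => PrimalDual.grad f x s) (Set.Ici 0) t‖ ≤ β₂) →
      ∀ zstar : ℝ → PrimalDual.State n k,
        (∀ t : ℝ, 0 ≤ t → PrimalDual.IsOptimizer A b f t (zstar t)) →
        (∀ z : ℝ → PrimalDual.State n k, PrimalDual.IsTrajectory (PrimalDual.field A b f) 0 z →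
          ∀ t : ℝ, 0 ≤ t →
            PrimalDual.normP A linf lsup ε (z t - zstar t) ≤
              (PrimalDual.normP A linf lsup ε (z 0 - zstar 0) -
                  PrimalDual.rho A linf lsup ε β₁ β₂ / PrimalDual.rate A linf lsup ε) *
                Real.exp (-PrimalDual.rate A linf lsup ε * t) +
              PrimalDual.rho A linf lsup ε β₁ β₂ / PrimalDual.rate A linf lsup ε) ∧
        (∀ δ R : ℝ, 0 < δ → 0 < R → ∃ T : ℝ, 0 ≤ T ∧
          ∀ (t₀ : ℝ) (z : ℝ → PrimalDual.State n k), 0 ≤ t₀ →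
            PrimalDual.IsTrajectory (PrimalDual.field A b f) t₀ z →
            PrimalDual.normP A linf lsup ε (z t₀ - zstar t₀) ≤ R →
            ∀ t : ℝ, t₀ + T ≤ t →
              PrimalDual.normP A linf lsup ε (z t - zstar t) ≤
                PrimalDual.rho A linf lsup ε β₁ β₂ / PrimalDual.rate A linf lsup ε + δ)) := by
  have hn : 0 < n := hk.trans hkn
  have hreg : ∀ t, 0 ≤ t → PrimalDual.IsRegularAt f linf lsup t := fun t ht =>
    ⟨hf t ht, hconvex t ht, hsmooth t ht⟩
  have hle := (hreg 0 le_rfl).linf_le_lsup hn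
  have hs : 0 < PrimalDual.sigmaMax A := PrimalDual.sigmaMax_pos (hk.trans_eq hA.symm)
  have hm : 0 < PrimalDual.sigmaMin A := PrimalDual.sigmaMin_pos hk hA
  have hP := PrimalDual.posDef_weightP (A := A) hs hlinf hle hε₀ hε₁
  have hF := PrimalDual.isDissipative_field (A := A) hn hk hA hlinf hε₀ hε₁ hreg
    (fun x => (hgrad x).continuousOn) hb.continuousOn
  have hopt : ∀ {t}, 0 ≤ t → ∀ {z}, PrimalDual.IsOptimizer A b f t z ↔
      PrimalDual.field A b f z t = 0 := fun ht _ => (hreg _ ht).isOptimizer_iff hlinf.le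
  refine ⟨⟨hP, hF.isContractive,
    PrimalDual.hasContractionRate_field hn hk hA hlinf hε₀ hε₁ hreg⟩, fun t ht => ?_, ?_⟩
  · obtain ⟨z, hz⟩ := hF.exists_zero ht
    exact ⟨z, (hopt ht).2 hz, fun w hw => hF.zero_unique ht ((hopt ht).1 hw) hz⟩
  intro β₁ β₂ hβ₁ hβ₂ hb₁ hb₂ zstar hz
  have hlipz : ∀ s t, 0 ≤ s → 0 ≤ t → ‖PrimalDual.sqrtWeight A linf lsup ε (zstar t - zstar s)‖ ≤
      PrimalDual.rho A linf lsup ε β₁ β₂ * |t - s| := by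
    intro s t hs ht
    refine (PrimalDual.sqrtWeight_norm_le hn hP _).trans ?_
    rw [PrimalDual.rho, mul_assoc]
    refine mul_le_mul_of_nonneg_left ?_ (zero_le_one.trans (PrimalDual.one_le_lambdaMax hn))
    exact PrimalDual.norm_optimizer_sub_le hk hA hlinf hlsup hreg hgrad hb hb₁ hb₂ hz hs ht
  have hρ : 0 ≤ PrimalDual.rho A linf lsup ε β₁ β₂ := by
    have := (norm_nonneg _).trans (hlipz 0 1 le_rfl zero_le_one)
    simpa using this
  -- The `2` inverts the lower bound `1/2` of `‖S ·‖` against the Euclidean norm.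
  have hzc : ContinuousOn zstar (Set.Ici 0) := by
    refine (LipschitzOnWith.of_dist_le_mul
      (K := ⟨2 * PrimalDual.rho A linf lsup ε β₁ β₂, by positivity⟩) fun t ht s hs => ?_).continuousOn
    rw [dist_eq_norm, Real.dist_eq]
    change _ ≤ 2 * PrimalDual.rho A linf lsup ε β₁ β₂ * |t - s|
    have h1 := hF.lower (zstar t - zstar s)
    have h2 := hlipz s t hs ht
    linarith
  have track : ∀ (t₀ : ℝ) (z : ℝ → PrimalDual.State n k), 0 ≤ t₀ →
      PrimalDual.IsTrajectory (PrimalDual.field A b f) t₀ z → ∀ t, t₀ ≤ t →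
      PrimalDual.normP A linf lsup ε (z t - zstar t) ≤
        (PrimalDual.normP A linf lsup ε (z t₀ - zstar t₀) -
          PrimalDual.rho A linf lsup ε β₁ β₂ / PrimalDual.rate A linf lsup ε) *
          Real.exp (-PrimalDual.rate A linf lsup ε * (t - t₀)) +
        PrimalDual.rho A linf lsup ε β₁ β₂ / PrimalDual.rate A linf lsup ε := by
    intro t₀ z ht₀ hzt t ht
    refine hF.norm_map_sub_le_of_defect ht₀ hzt (hzc.mono (Set.Ici_subset_Ici.2 ht₀)) ?_ ht
    intro r hr η hη
    filter_upwards [self_mem_nhdsWithin] with s hsr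
    have hr0 : 0 ≤ r := ht₀.trans hr
    have hpos : 0 < s - r := sub_pos.2 hsr
    have h1 := hlipz r s hr0 (by linarith)
    rw [abs_of_pos hpos] at h1
    -- The field vanishes at the optimizer, so the defect is just the increment of `z*`.
    rw [(hopt hr0).1 (hz r hr0), smul_zero, sub_zero]
    refine h1.trans ?_
    gcongr
    linarith
  refine ⟨fun z hzt t ht => ?_, fun δ R hδ hR => ?_⟩
  · simpa using track 0 z le_rfl hzt t ht
  · have hc := hF.rate_pos
    -- This time solves `R exp (-c T) = δ`; the maximum with `0` covers `R < δ`.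
    refine ⟨max 0 (Real.log (R / δ) / PrimalDual.rate A linf lsup ε), le_max_left _ _,
      fun t₀ z ht₀ hzt hzR t ht => ?_⟩
    set c := PrimalDual.rate A linf lsup ε
    have hT0 := le_max_left 0 (Real.log (R / δ) / c)
    have hT1 := le_max_right 0 (Real.log (R / δ) / c)
    have h1 := track t₀ z ht₀ hzt t (by linarith)
    have h2 : Real.log (R / δ) ≤ c * (t - t₀) := by
      have : Real.log (R / δ) / c ≤ t - t₀ := by linarith
      rwa [div_le_iff₀ hc, mul_comm] at this
    have h3 : R * Real.exp (-c * (t - t₀)) ≤ δ := by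
      have h4 := Real.exp_le_exp.2 h2
      rw [Real.exp_log (by positivity), div_le_iff₀ hδ] at h4
      rw [neg_mul, Real.exp_neg, ← div_eq_mul_inv, div_le_iff₀ (Real.exp_pos _)]
      linarith
    have h5 : (PrimalDual.normP A linf lsup ε (z t₀ - zstar t₀) -
        PrimalDual.rho A linf lsup ε β₁ β₂ / c) * Real.exp (-c * (t - t₀)) ≤
        R * Real.exp (-c * (t - t₀)) := by
      refine mul_le_mul_of_nonneg_right ?_ (Real.exp_pos _).le
      have : 0 ≤ PrimalDual.rho A linf lsup ε β₁ β₂ / c := by positivity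
      linarith
    linarith
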